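/- **The calculus $\mathsf{Eff}_\le$.** Fix a signature $\Sigma$: base types $O$ (including $\mathit{Bool}$); constants $c$ of base type $\Sigma(c)$ (including distinct $\mathsf{true},\mathsf{false}:\mathit{Bool}$); operators $\mathit{op}$ with $\Sigma(\mathit{op})=(\overline O)\to O$ (including conjunction $\&:(\mathit{Bool},\mathit{Bool})\to\mathit{Bool}$); tables $t$ with $\Sigma(t)=[R]$. A row type $R$ is a record type with pairwise distinct labels and components of base type. Ground effects are $X,Y::=\mathsf{pl}\mid\mathsf{db}$, effects $E::=X\mid\mathsf{any}$, and $\le$ is the least reflexive relation with $\mathsf{any}\le\mathsf{pl}$, $\mathsf{any}\le\mathsf{db}$. Types are $A,B::=O\mid\langle\overline{\ell:A}\rangle\mid[A]\mid A\to^E B$. Terms, up to renaming of bound variables, are $$x\mid c\mid \mathit{op}(\overline M)\mid\lambda^E x^A.M\mid M\,N\mid \mathsf{if}\,L\,M\mid\langle\overline{\ell=M}\rangle\mid M.\ell\mid[\,]\mid[M]\mid M\uplus N\mid\mathsf{for}(x^A\leftarrow M)\,N\mid \mathsf{rec}\,f^{A\to^{\mathsf{pl}}B}\,x^A.M\mid\mathsf{fold}\,L\,M\,N\mid\mathsf{query}\,M\mid\mathsf{table}\,t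 .$$ **Typing** $\Gamma\vdash M:A\,!\,E$. The following hold for every $E$ (and $E'$). Variables have their type in $\Gamma$, and $c:\Sigma(c)$. If $\Sigma(\mathit{op})=(\overline O)\to O$ and $\overline{M:O}$ at $E$, then $\mathit{op}(\overline M):O\,!\,E$. If $\Gamma,x:A\vdash M:B\,!\,E$ then $\lambda^Ex^A.M:A\to^EB\,!\,E'$. If $M:A\to^{E'}B\,!\,E$, $N:A\,!\,E$ and $E'\le E$ then $M\,N:B\,!\,E$. If $L:\mathit{Bool}\,!\,E$ and $M:[A]\,!\,E$ then $\mathsf{if}\,L\,M:[A]\,!\,E$. Records (with distinct labels), projections, $[\,]:[A]$ (for every $A$), $[M]$ and $M\uplus N$ are typed as usual, at the effect of their parts. If $M:[A]\,!\,E$ and $\Gamma,x:A\vdash N:[B]\,!\,E$ then $\mathsf{for}(x^A\leftarrow M)N:[B]\,!\,E$. If $\Gamma,f:A\to^{\mathsf{pl}}B,x:A\vdash M:B\,!\,\mathsf{pl}$ then $\mathsf{rec}\,f\,x.M:A\to^{\mathsf{pl}}B\,!\,E$. In addition: $\mathsf{table}\,t:\Sigma(t)\,!\,\mathsf{db}$;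 if $M:[R]\,!\,\mathsf{db}$ for a row type $R$ then $\mathsf{query}\,M:[R]\,!\,\mathsf{pl}$; if $L:[A]\,!\,\mathsf{pl}$, $M:B\,!\,\mathsf{pl}$ and $N:A\to^{\mathsf{pl}}B\to^{\mathsf{pl}}B\,!\,\mathsf{pl}$ then $\mathsf{fold}\,L\,M\,N:B\,!\,\mathsf{pl}$. **Query normalisation.** Let $\leadsto$ and $\hookrightarrow$ be the closures under all term formers of, respectively, the rules $$\begin{aligned}&(\lambda x.M)N\leadsto M[x:=N],\quad \langle\overline{\ell=M}\rangle.\ell_i\leadsto M_i,\quad \mathsf{if}\,\mathsf{true}\,M\leadsto M,\quad \mathsf{if}\,\mathsf{false}\,M\leadsto[\,],\\ &\mathsf{for}(x\leftarrow[M])N\leadsto N[x:=M],\quad \mathsf{for}(x\leftarrow[\,])N\leadsto[\,],\quad \mathsf{for}(x\leftarrow\mathsf{if}\,L\,M)N\leadsto\mathsf{if}\,L\,(\mathsf{for}(x\leftarrow M)N),\\ &\mathsf{for}(y\leftarrow\mathsf{for}(x\leftarrow L)M)N\leadsto\mathsf{for}(x\leftarrow L)\,\mathsf{for}(y\leftarrow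 M)N,\\ &\mathsf{for}(x\leftarrow L\uplus M)N\leadsto(\mathsf{for}(x\leftarrow L)N)\uplus(\mathsf{for}(x\leftarrow M)N)\end{aligned}$$ and $$\begin{aligned}&\mathsf{for}(x\leftarrow L)(M\uplus N)\hookrightarrow(\mathsf{for}(x\leftarrow L)M)\uplus(\mathsf{for}(x\leftarrow L)N),\quad \mathsf{for}(x\leftarrow L)[\,]\hookrightarrow[\,],\quad \mathsf{if}\,L\,[\,]\hookrightarrow[\,],\\ &\mathsf{if}\,L\,(M\uplus N)\hookrightarrow(\mathsf{if}\,L\,M)\uplus(\mathsf{if}\,L\,N),\quad \mathsf{if}\,L\,(\mathsf{if}\,M\,N)\hookrightarrow\mathsf{if}\,(L\,\&\,M)\,N,\\ &\mathsf{if}\,L\,(\mathsf{for}(x\leftarrow M)N)\hookrightarrow\mathsf{for}(x\leftarrow M)(\mathsf{if}\,L\,N)\end{aligned}$$ (bound variables chosen so that nothing is captured). Write $|L|=N$ if $L\leadsto^*M\hookrightarrow^*N$ for some $\leadsto$-normal $M$, with $N$ being $\hookrightarrow$-normal. **Operational semantics.** Values are $V,W::=c\mid\lambda^E x^A.M\mid\mathsf{rec}\,f\,x.M\mid\langle\overline{\ell=V}\rangle\mid[V_1]\uplus(\cdots\uplus([V_n]\uplus[\,]))$,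 $n\ge0$. Let $\delta$ interpret each operator as a function on constants and respect the types in $\Sigma$. Let $\Omega$ be a set of pairs $(q,V)$ of a query and a response, where $V$ is a value and, for every row type $R$, $\vdash q:[R]\,!\,\mathsf{db}$ implies $\vdash V:[R]\,!\,\mathsf{pl}$. The transitions $M\xrightarrow{\mu}N$, with $\mu$ either silent ($\tau$) or in $\Omega$, are: $\mathsf{query}\,M\xrightarrow{(q,V)}V$ whenever $|M|=q$ and $(q,V)\in\Omega$; the silent steps $$\begin{aligned}&\mathit{op}(\overline c)\to\delta(\mathit{op},\overline c),\quad(\lambda x.M)V\to M[x:=V],\quad(\mathsf{rec}\,f\,x.M)V\to M[f:=\mathsf{rec}\,f\,x.M,\,x:=V],\\ &\langle\overline{\ell=V}\rangle.\ell_i\to V_i,\quad\mathsf{if}\,\mathsf{true}\,M\to M,\quad\mathsf{if}\,\mathsf{false}\,M\to[\,],\\ &[V]\to[V]\uplus[\,],\quad[\,]\uplus V\to V,\quad([V]\uplus V')\uplus V''\to[V]\uplus(V'\uplus V''),\\ &\mathsf{for}(x\leftarrow[\,])N\to[\,],\quad\mathsf{for}(x\leftarrow[V]\uplus W)N\to N[x:=V]\uplus(\mathsf{for}(x\leftarrow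 W)N),\\ &\mathsf{fold}\,[\,]\,M\,N\to M,\quad\mathsf{fold}\,([V]\uplus W)\,M\,N\to N\,V\,(\mathsf{fold}\,W\,M\,N);\end{aligned}$$ and the closure of all these under the evaluation contexts $$\begin{aligned}\mathcal E::={}&[\;]\mid\mathit{op}(\overline V,\mathcal E,\overline M)\mid\mathcal E\,M\mid V\,\mathcal E\mid\langle\overline{\ell=V},\ell'=\mathcal E,\overline{\ell''=M}\rangle\mid\mathcal E.\ell\mid[\mathcal E]\\ &\mid\mathcal E\uplus M\mid[V]\uplus\mathcal E\mid V\uplus\mathcal E\mid\mathsf{for}(x\leftarrow\mathcal E)N\mid\mathsf{if}\,\mathcal E\,M\mid\mathsf{fold}\,\mathcal E\,M\,N,\end{aligned}$$ except that in $\mathcal E\uplus M$ the left operand takes no step when it already has the form $[V]$ with $V$ a value. **Traces.** Write $\Longrightarrow$ for $\xrightarrow{\tau}{}^*$ and $\overset{\mu}{\Longrightarrow}$ for $\Longrightarrow\xrightarrow{\mu}\Longrightarrow$. A run from $M_1$ is a finite (possibly empty) or infinite sequence $M_1\overset{\mu_1}{\Longrightarrow}M_2\overset{\mu_2}{\Longrightarrow}\cdots$;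 its trace is the finite or infinite word obtained from $\mu_1\mu_2\cdots$ by deleting all $\tau$. $Tr(M)$ is the set of traces of all runs from $M$, and $M\eqsim N$ means $Tr(M)=Tr(N)$. **Doubling.** On types, $⟦-⟧$ preserves all type formers, including $\to^{\mathsf{pl}}$ and $\to^{\mathsf{db}}$, except that $⟦A\to^{\mathsf{any}}B⟧=\langle1:⟦A⟧\to^{\mathsf{pl}}⟦B⟧,\;2:⟦A⟧\to^{\mathsf{db}}⟦B⟧\rangle$. On terms, $⟦M⟧_X$ is defined by recursion on a derivation of $\Gamma\vdash M:A\,!\,E$ with $E\le X$. It commutes with all term formers, applying $⟦-⟧$ to type annotations and translating subterms at the same $X$, except that $$\begin{aligned}&⟦\lambda^Yx^A.M⟧_X=\lambda^Yx^{⟦A⟧}.⟦M⟧_Y\ (Y\in\{\mathsf{pl},\mathsf{db}\}),\quad⟦\lambda^{\mathsf{any}}x^A.M⟧_X=\langle1=\lambda^{\mathsf{pl}}x^{⟦A⟧}.⟦M⟧_{\mathsf{pl}},\,2=\lambda^{\mathsf{db}}x^{⟦A⟧}.⟦M⟧_{\mathsf{db}}\rangle,\\ &⟦M\,N⟧_{\mathsf{pl}}=⟦M⟧_{\mathsf{pl}}.1\;⟦N⟧_{\mathsf{pl}}\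 \text{ and }\ ⟦M\,N⟧_{\mathsf{db}}=⟦M⟧_{\mathsf{db}}.2\;⟦N⟧_{\mathsf{db}}\quad\text{if } M:A\to^{\mathsf{any}}B\text{ in the derivation},\\ &⟦\mathsf{rec}\,f^{A\to^{\mathsf{pl}}B}\,x^A.M⟧_X=\mathsf{rec}\,f^{⟦A⟧\to^{\mathsf{pl}}⟦B⟧}\,x^{⟦A⟧}.⟦M⟧_{\mathsf{pl}},\qquad⟦\mathsf{query}\,M⟧_{\mathsf{pl}}=\mathsf{query}\,⟦M⟧_{\mathsf{db}}.\end{aligned}$$ **Corollary.** For all $\Sigma,\delta,\Omega$ as above, every closed term $M$ and type $A$, and every derivation of $\vdash M:A\,!\,\mathsf{pl}$, we have $M\eqsim⟦M⟧_{\mathsf{pl}}$, where $⟦M⟧_{\mathsf{pl}}$ is the translation along that derivation. -/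

import Mathlib

namespace EffLang

/-! ## Labelled transition systems and traces

Labels are `Option L`: `none` is the silent action `τ`, `some l` is a visible action. -/

/-- A finite or infinite word over `L`. -/
inductive Word (L : Type) : Type
  | fin (w : List L) : Word L
  | inf (w : ℕ → L) : Word L

section LTS

variable {X Y L : Type}

/-- `x ⟹ y`: finitely many silent transitions. -/
def Silent (step : X → Option L → X → Prop) : X → X → Prop :=
  Relation.ReflTransGen (fun x y => step x none y)

/-- `x ⟹μ y`, i.e. `⟹ ∘ —μ→ ∘ ⟹`. -/
def Weak (step : X → Option L → X → Prop) (x : X) (μ : Option L) (y : X) : Prop :=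
  ∃ x' y', Silent step x x' ∧ step x' μ y' ∧ Silent step y' y

/-- Finite runs of weak transitions, with the list of their labels. -/
inductive FinRun (step : X → Option L → X → Prop) : X → List (Option L) → X → Prop
  | nil (x : X) : FinRun step x [] x
  | cons {x y z : X} {μ : Option L} {μs : List (Option L)} :
      Weak step x μ y → FinRun step y μs z → FinRun step x (μ :: μs) z

/-- `ErasesTo μ w`: deleting all occurrences of `τ` from the infinite sequence `μ` of labels leaves
the word `w`, which is finite exactly if `μ` is eventually silent. -/
def ErasesTo (μ : ℕ → Option L) : Word L → Prop
  | .fin w => ∃ n, (∀ m, n ≤ m → μ m = none) ∧ w = ((List.range n).map μ).reduceOption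
  | .inf w => ∃ φ : ℕ → ℕ, StrictMono φ ∧ (∀ k, μ (φ k) = some (w k)) ∧
      ∀ m, μ m ≠ none → ∃ k, φ k = m

/-- The set of the traces of all finite and infinite runs that start at `x`. -/
def Tr (step : X → Option L → X → Prop) (x : X) : Set (Word L) :=
  {w | (∃ μs y, FinRun step x μs y ∧ w = Word.fin μs.reduceOption) ∨
       (∃ (xs : ℕ → X) (μ : ℕ → Option L), xs 0 = x ∧
          (∀ n, Weak step (xs n) (μ n) (xs (n + 1))) ∧ ErasesTo μ w)}

/-- Trace equivalence of a state of one system and a state of another. -/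
def TraceEquiv (stepX : X → Option L → X → Prop) (stepY : Y → Option L → Y → Prop)
    (x : X) (y : Y) : Prop :=
  Tr stepX x = Tr stepY y

end LTS

/-! ## Effects, types, signatures -/

/-- Ground effects: programming language and database. -/
inductive Ground : Type
  | pl | db

inductive Eff : Type
  | ground (X : Ground) : Eff
  | any : Eff

abbrev Eff.pl : Eff := .ground .pl
abbrev Eff.db : Eff := .ground .db

/-- Subeffecting `E₁ ≤ E₂`. -/
inductive Eff.Sub : Eff → Eff → Prop
  | refl (E : Eff) : Eff.Sub E E
  | anyPl : Eff.Sub .any .pl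
  | anyDb : Eff.Sub .any .db

/-- Record types have a finite family of (label, type) fields; labels are natural numbers. -/
inductive Ty (B : Type) : Type
  | base (O : B) : Ty B
  | record (n : ℕ) (ls : Fin n → ℕ) (As : Fin n → Ty B) : Ty B
  | bag (A : Ty B) : Ty B
  | arrow (A : Ty B) (E : Eff) (A' : Ty B) : Ty B

/-- Flat record types: pairwise distinct labels, base types only. -/
structure Row (B : Type) where
  width : ℕ
  label : Fin width → ℕ
  label_injective : Function.Injective label
  base : Fin width → B

/-- The flat record type of a row, as a type. -/
def Row.toTy {B : Type} (R : Row B) : Ty B :=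
  .record R.width R.label (fun i => .base (R.base i))

/-- A signature: base types (among them the Booleans), typed constants (among them `true` and
`false`), typed primitive operators (among them conjunction) and tables with their row types. -/
structure Signature where
  Base : Type
  Const : Type
  Op : Type
  Table : Type
  constTy : Const → Base
  arity : Op → ℕ
  opDom : (o : Op) → Fin (arity o) → Base
  opCod : Op → Base
  tableRow : Table → Row Base
  bool : Base
  tt : Const
  ff : Const
  constTy_tt : constTy tt = bool
  constTy_ff : constTy ff = bool
  tt_ne_ff : tt ≠ ff
  conj : Op
  arity_conj : arity conj = 2
  opDom_conj : ∀ i, opDom conj i = bool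
  opCod_conj : opCod conj = bool

/-! ## Terms (de Bruijn indices; terms are thus identified up to renaming of bound variables) -/

inductive Tm (S : Signature) : Type
  | var (x : ℕ) : Tm S
  | const (c : S.Const) : Tm S
  | op (o : S.Op) (Ms : Fin (S.arity o) → Tm S) : Tm S
  /-- `λ^E x^A. M`; index `0` of `M` is `x` -/
  | lam (E : Eff) (A : Ty S.Base) (M : Tm S) : Tm S
  | app (M N : Tm S) : Tm S
  /-- `if L M`, the one-sided conditional -/
  | ite (L M : Tm S) : Tm S
  | record (n : ℕ) (ls : Fin n → ℕ) (Ms : Fin n → Tm S) : Tm S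
  | proj (M : Tm S) (l : ℕ) : Tm S
  | empty : Tm S
  | single (M : Tm S) : Tm S
  | union (M N : Tm S) : Tm S
  /-- `for (x^A ← M) N`; index `0` of `N` is `x` -/
  | for (A : Ty S.Base) (M N : Tm S) : Tm S
  /-- `rec f^{A →pl B} x^A. M`; index `0` of `M` is `x`, index `1` is `f` -/
  | recFn (A B : Ty S.Base) (M : Tm S) : Tm S
  | fold (L M N : Tm S) : Tm S
  | query (M : Tm S) : Tm S
  | table (t : S.Table) : Tm S

/-- A renaming under one more binder. -/
def upRen (ξ : ℕ → ℕ) : ℕ → ℕ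
  | 0 => 0
  | n + 1 => ξ n + 1

namespace Tm

variable {S : Signature}

def rename : (ℕ → ℕ) → Tm S → Tm S
  | ξ, .var x => .var (ξ x)
  | _, .const c => .const c
  | ξ, .op o Ms => .op o (fun i => (Ms i).rename ξ)
  | ξ, .lam E A M => .lam E A (M.rename (upRen ξ))
  | ξ, .app M N => .app (M.rename ξ) (N.rename ξ)
  | ξ, .ite L M => .ite (L.rename ξ) (M.rename ξ)
  | ξ, .record n ls Ms => .record n ls (fun i => (Ms i).rename ξ)
  | ξ, .proj M l => .proj (M.rename ξ) l
  | _, .empty => .empty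
  | ξ, .single M => .single (M.rename ξ)
  | ξ, .union M N => .union (M.rename ξ) (N.rename ξ)
  | ξ, .for A M N => .for A (M.rename ξ) (N.rename (upRen ξ))
  | ξ, .recFn A B M => .recFn A B (M.rename (upRen (upRen ξ)))
  | ξ, .fold L M N => .fold (L.rename ξ) (M.rename ξ) (N.rename ξ)
  | ξ, .query M => .query (M.rename ξ)
  | _, .table t => .table t

/-- A substitution under one more binder. -/
def upSub (σ : ℕ → Tm S) : ℕ → Tm S
  | 0 => .var 0
  | n + 1 => (σ n).rename Nat.succ

/-- Simultaneous capture-avoiding substitution. -/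
def subst : (ℕ → Tm S) → Tm S → Tm S
  | σ, .var x => σ x
  | _, .const c => .const c
  | σ, .op o Ms => .op o (fun i => (Ms i).subst σ)
  | σ, .lam E A M => .lam E A (M.subst (upSub σ))
  | σ, .app M N => .app (M.subst σ) (N.subst σ)
  | σ, .ite L M => .ite (L.subst σ) (M.subst σ)
  | σ, .record n ls Ms => .record n ls (fun i => (Ms i).subst σ)
  | σ, .proj M l => .proj (M.subst σ) l
  | _, .empty => .empty
  | σ, .single M => .single (M.subst σ)
  | σ, .union M N => .union (M.subst σ) (N.subst σ)
  | σ, .for A M N => .for A (M.subst σ) (N.subst (upSub σ))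
  | σ, .recFn A B M => .recFn A B (M.subst (upSub (upSub σ)))
  | σ, .fold L M N => .fold (L.subst σ) (M.subst σ) (N.subst σ)
  | σ, .query M => .query (M.subst σ)
  | _, .table t => .table t

/-- `M[x := N]` for `x` the variable with index `0`. -/
def inst (M N : Tm S) : Tm S :=
  M.subst (fun
    | 0 => N
    | n + 1 => .var n)

/-- `M[x := N, f := F]` for `x`, `f` the variables with indices `0`, `1`. -/
def inst₂ (M N F : Tm S) : Tm S :=
  M.subst (fun
    | 0 => N
    | 1 => F
    | n + 2 => .var n)

/-- `L & M`: the conjunction operator applied to `L` and `M`. -/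
def and (L M : Tm S) : Tm S :=
  .op S.conj (fun i => if i.val = 0 then L else M)

/-- The pair `⟨M, N⟩`: a record with labels `1` and `2`. -/
def pair (M N : Tm S) : Tm S :=
  .record 2 ![1, 2] ![M, N]

/-- `[V₁] ⊎ (… ⊎ ([Vₙ] ⊎ []))` -/
def coll : List (Tm S) → Tm S
  | [] => .empty
  | V :: Vs => .union (.single V) (coll Vs)

end Tm

/-! ## Typing

`Typed Γ M A E` is the type of derivations of `Γ ⊢ M : A ! E`. -/

inductive Typed {S : Signature} : List (Ty S.Base) → Tm S → Ty S.Base → Eff → Type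
  | var {Γ : List (Ty S.Base)} {x : ℕ} {A : Ty S.Base} {E : Eff} :
      Γ[x]? = some A → Typed Γ (.var x) A E
  | const {Γ : List (Ty S.Base)} {c : S.Const} {O : S.Base} {E : Eff} :
      S.constTy c = O → Typed Γ (.const c) (.base O) E
  | op {Γ : List (Ty S.Base)} {o : S.Op} {Ms : Fin (S.arity o) → Tm S} {O : S.Base} {E : Eff} :
      (∀ i, Typed Γ (Ms i) (.base (S.opDom o i)) E) → S.opCod o = O →
      Typed Γ (.op o Ms) (.base O) E
  | lam {Γ : List (Ty S.Base)} {M : Tm S} {A B : Ty S.Base} {E E' : Eff} :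
      Typed (A :: Γ) M B E → Typed Γ (.lam E A M) (.arrow A E B) E'
  | app {Γ : List (Ty S.Base)} {M N : Tm S} {A B : Ty S.Base} {E E' : Eff} :
      Typed Γ M (.arrow A E' B) E → Typed Γ N A E → Eff.Sub E' E → Typed Γ (.app M N) B E
  | ite {Γ : List (Ty S.Base)} {L M : Tm S} {A : Ty S.Base} {E : Eff} :
      Typed Γ L (.base S.bool) E → Typed Γ M (.bag A) E → Typed Γ (.ite L M) (.bag A) E
  | record {Γ : List (Ty S.Base)} {n : ℕ} {ls : Fin n → ℕ} {Ms : Fin n → Tm S}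
      {As : Fin n → Ty S.Base} {E : Eff} :
      Function.Injective ls → (∀ i, Typed Γ (Ms i) (As i) E) →
      Typed Γ (.record n ls Ms) (.record n ls As) E
  | proj {Γ : List (Ty S.Base)} {n : ℕ} {ls : Fin n → ℕ} {M : Tm S}
      {As : Fin n → Ty S.Base} {l : ℕ} {A : Ty S.Base} {E : Eff} (i : Fin n) :
      Typed Γ M (.record n ls As) E → ls i = l → As i = A → Typed Γ (.proj M l) A E
  | empty {Γ : List (Ty S.Base)} {A : Ty S.Base} {E : Eff} : Typed Γ .empty (.bag A) E
  | single {Γ : List (Ty S.Base)} {M : Tm S} {A : Ty S.Base} {E : Eff} :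
      Typed Γ M A E → Typed Γ (.single M) (.bag A) E
  | union {Γ : List (Ty S.Base)} {M N : Tm S} {A : Ty S.Base} {E : Eff} :
      Typed Γ M (.bag A) E → Typed Γ N (.bag A) E → Typed Γ (.union M N) (.bag A) E
  | for {Γ : List (Ty S.Base)} {M N : Tm S} {A B : Ty S.Base} {E : Eff} :
      Typed Γ M (.bag A) E → Typed (A :: Γ) N (.bag B) E → Typed Γ (.for A M N) (.bag B) E
  | table {Γ : List (Ty S.Base)} {t : S.Table} :
      Typed Γ (.table t) (.bag (S.tableRow t).toTy) .db
  | query {Γ : List (Ty S.Base)} {M : Tm S} {R : Row S.Base} :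
      Typed Γ M (.bag R.toTy) .db → Typed Γ (.query M) (.bag R.toTy) .pl
  | recFn {Γ : List (Ty S.Base)} {M : Tm S} {A B : Ty S.Base} {E : Eff} :
      Typed (A :: .arrow A .pl B :: Γ) M B .pl →
      Typed Γ (.recFn A B M) (.arrow A .pl B) E
  | fold {Γ : List (Ty S.Base)} {L M N : Tm S} {A B : Ty S.Base} :
      Typed Γ L (.bag A) .pl → Typed Γ M B .pl →
      Typed Γ N (.arrow A .pl (.arrow B .pl B)) .pl →
      Typed Γ (.fold L M N) B .pl

/-! ## Query normalisation -/

/-- Closure of a relation on terms under all term formers. -/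
inductive Compat {S : Signature} (R : Tm S → Tm S → Prop) : Tm S → Tm S → Prop
  | here {M M' : Tm S} : R M M' → Compat R M M'
  | op {o : S.Op} {Ms : Fin (S.arity o) → Tm S} {M' : Tm S} (i : Fin (S.arity o)) :
      Compat R (Ms i) M' → Compat R (.op o Ms) (.op o (Function.update Ms i M'))
  | lam {E : Eff} {A : Ty S.Base} {M M' : Tm S} :
      Compat R M M' → Compat R (.lam E A M) (.lam E A M')
  | appL {M M' N : Tm S} : Compat R M M' → Compat R (.app M N) (.app M' N)
  | appR {M N N' : Tm S} : Compat R N N' → Compat R (.app M N) (.app M N')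
  | iteL {L L' M : Tm S} : Compat R L L' → Compat R (.ite L M) (.ite L' M)
  | iteR {L M M' : Tm S} : Compat R M M' → Compat R (.ite L M) (.ite L M')
  | record {n : ℕ} {ls : Fin n → ℕ} {Ms : Fin n → Tm S} {M' : Tm S} (i : Fin n) :
      Compat R (Ms i) M' → Compat R (.record n ls Ms) (.record n ls (Function.update Ms i M'))
  | proj {M M' : Tm S} {l : ℕ} : Compat R M M' → Compat R (.proj M l) (.proj M' l)
  | single {M M' : Tm S} : Compat R M M' → Compat R (.single M) (.single M')
  | unionL {M M' N : Tm S} : Compat R M M' → Compat R (.union M N) (.union M' N)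
  | unionR {M N N' : Tm S} : Compat R N N' → Compat R (.union M N) (.union M N')
  | forL {A : Ty S.Base} {M M' N : Tm S} : Compat R M M' → Compat R (.for A M N) (.for A M' N)
  | forR {A : Ty S.Base} {M N N' : Tm S} : Compat R N N' → Compat R (.for A M N) (.for A M N')
  | recFn {A B : Ty S.Base} {M M' : Tm S} :
      Compat R M M' → Compat R (.recFn A B M) (.recFn A B M')
  | foldL {L L' M N : Tm S} : Compat R L L' → Compat R (.fold L M N) (.fold L' M N)
  | foldM {L M M' N : Tm S} : Compat R M M' → Compat R (.fold L M N) (.fold L M' N)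
  | foldR {L M N N' : Tm S} : Compat R N N' → Compat R (.fold L M N) (.fold L M N')
  | query {M M' : Tm S} : Compat R M M' → Compat R (.query M) (.query M')

/-- Stage 1 rules: symbolic reduction. -/
inductive Stage1 {S : Signature} : Tm S → Tm S → Prop
  | beta {E : Eff} {A : Ty S.Base} {M N : Tm S} : Stage1 (.app (.lam E A M) N) (M.inst N)
  | proj {n : ℕ} {ls : Fin n → ℕ} {Ms : Fin n → Tm S} {l : ℕ} (i : Fin n) :
      ls i = l → Stage1 (.proj (.record n ls Ms) l) (Ms i)
  | forSingle {A : Ty S.Base} {M N : Tm S} : Stage1 (.for A (.single M) N) (N.inst M)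
  /-- `N` has the one bound variable `y`; it is moved below the additional binder `x`. -/
  | forFor {A B : Ty S.Base} {L M N : Tm S} :
      Stage1 (.for B (.for A L M) N) (.for A L (.for B M (N.rename (upRen Nat.succ))))
  | forIte {A : Ty S.Base} {L M N : Tm S} :
      Stage1 (.for A (.ite L M) N) (.ite L (.for A M N))
  | forEmpty {A : Ty S.Base} {N : Tm S} : Stage1 (.for A .empty N) .empty
  | forUnion {A : Ty S.Base} {L M N : Tm S} :
      Stage1 (.for A (.union L M) N) (.union (.for A L N) (.for A M N))
  | iteTrue {M : Tm S} : Stage1 (.ite (.const S.tt) M) M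
  | iteFalse {M : Tm S} : Stage1 (.ite (.const S.ff) M) .empty

/-- Stage 2 rules: ad hoc reduction. -/
inductive Stage2 {S : Signature} : Tm S → Tm S → Prop
  | forUnion {A : Ty S.Base} {L M N : Tm S} :
      Stage2 (.for A L (.union M N)) (.union (.for A L M) (.for A L N))
  | forEmpty {A : Ty S.Base} {L : Tm S} : Stage2 (.for A L .empty) .empty
  | iteUnion {L M N : Tm S} : Stage2 (.ite L (.union M N)) (.union (.ite L M) (.ite L N))
  | iteEmpty {L : Tm S} : Stage2 (.ite L .empty) .empty
  | iteIte {L M N : Tm S} : Stage2 (.ite L (.ite M N)) (.ite (Tm.and L M) N)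
  | iteFor {A : Ty S.Base} {L M N : Tm S} :
      Stage2 (.ite L (.for A M N)) (.for A M (.ite (L.rename Nat.succ) N))

/-- `M'` is a normal form of `M` for the relation generated by the rules `R`. -/
def NormalFormOf {S : Signature} (R : Tm S → Tm S → Prop) (M M' : Tm S) : Prop :=
  Relation.ReflTransGen (Compat R) M M' ∧ ∀ N, ¬ Compat R M' N

/-- `|L| = N`: `N` is a stage 2 normal form of a stage 1 normal form of `L`. -/
def Normalises {S : Signature} (L N : Tm S) : Prop :=
  ∃ M, NormalFormOf Stage1 L M ∧ NormalFormOf Stage2 M N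

/-! ## Operational semantics -/

inductive Value {S : Signature} : Tm S → Prop
  | const (c : S.Const) : Value (.const c)
  | lam (E : Eff) (A : Ty S.Base) (M : Tm S) : Value (.lam E A M)
  | recFn (A B : Ty S.Base) (M : Tm S) : Value (.recFn A B M)
  | record {n : ℕ} {ls : Fin n → ℕ} {Vs : Fin n → Tm S} :
      (∀ i, Value (Vs i)) → Value (.record n ls Vs)
  | coll {M : Tm S} {Vs : List (Tm S)} : M = Tm.coll Vs → (∀ V ∈ Vs, Value V) → Value M

/-- An interpretation of the primitive operators on constants (the values of base types). -/
abbrev OpInterp (S : Signature) : Type :=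
  (o : S.Op) → (Fin (S.arity o) → S.Const) → S.Const

/-- The interpretation respects the types of the operators. -/
def OpInterp.RespectsTypes {S : Signature} (δ : OpInterp S) : Prop :=
  ∀ (o : S.Op) (cs : Fin (S.arity o) → S.Const),
    (∀ i, S.constTy (cs i) = S.opDom o i) → S.constTy (δ o cs) = S.opCod o

/-- A visible label: a query and the response to it. -/
abbrev Label (S : Signature) : Type := Tm S × Tm S

/-- Responses are values, and the response to a query of type `[R]` is of type `[R]`. -/
def RespectsTypes {S : Signature} (Ω : Set (Label S)) : Prop :=
  ∀ q V, (q, V) ∈ Ω → Value V ∧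
    ∀ R : Row S.Base, Nonempty (Typed [] q (.bag R.toTy) .db) →
      Nonempty (Typed [] V (.bag R.toTy) .pl)

/-- The transitions `M —μ→ N`. The congruence rules spell out the evaluation contexts. The rule
`singleton` makes the collection `[V]` out of the singleton expression `[V]`, except where the
latter is the left operand of a union, as in the collection `[V] ⊎ W`. -/
inductive Step {S : Signature} (δ : OpInterp S) (Ω : Set (Label S)) :
    Tm S → Option (Label S) → Tm S → Prop
  | delta {o : S.Op} {cs : Fin (S.arity o) → S.Const} :
      Step δ Ω (.op o (fun i => .const (cs i))) none (.const (δ o cs))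
  | beta {E : Eff} {A : Ty S.Base} {M V : Tm S} :
      Value V → Step δ Ω (.app (.lam E A M) V) none (M.inst V)
  | betaRec {A B : Ty S.Base} {M V : Tm S} :
      Value V → Step δ Ω (.app (.recFn A B M) V) none (M.inst₂ V (.recFn A B M))
  | proj {n : ℕ} {ls : Fin n → ℕ} {Vs : Fin n → Tm S} {l : ℕ} (i : Fin n) : ls i = l →
      (∀ j, Value (Vs j)) → Step δ Ω (.proj (.record n ls Vs) l) none (Vs i)
  | iteTrue {M : Tm S} : Step δ Ω (.ite (.const S.tt) M) none M
  | iteFalse {M : Tm S} : Step δ Ω (.ite (.const S.ff) M) none .empty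
  | singleton {V : Tm S} : Value V → Step δ Ω (.single V) none (.union (.single V) .empty)
  | unionEmpty {V : Tm S} : Value V → Step δ Ω (.union .empty V) none V
  | unionAssoc {V V' V'' : Tm S} : Value V → Value V' → Value V'' →
      Step δ Ω (.union (.union (.single V) V') V'') none (.union (.single V) (.union V' V''))
  | forEmpty {A : Ty S.Base} {N : Tm S} : Step δ Ω (.for A .empty N) none .empty
  | forUnion {A : Ty S.Base} {V W N : Tm S} : Value V → Value W →
      Step δ Ω (.for A (.union (.single V) W) N) none (.union (N.inst V) (.for A W N))
  | foldEmpty {M N : Tm S} : Step δ Ω (.fold .empty M N) none M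
  | foldUnion {V W M N : Tm S} : Value V → Value W →
      Step δ Ω (.fold (.union (.single V) W) M N) none (.app (.app N V) (.fold W M N))
  | query {M q V : Tm S} : Normalises M q → (q, V) ∈ Ω → Step δ Ω (.query M) (some (q, V)) V
  | opCtx {o : S.Op} {Ms : Fin (S.arity o) → Tm S} {μ : Option (Label S)} {N : Tm S}
      (i : Fin (S.arity o)) : (∀ j, j < i → Value (Ms j)) → Step δ Ω (Ms i) μ N →
      Step δ Ω (.op o Ms) μ (.op o (Function.update Ms i N))
  | appL {M M' N : Tm S} {μ : Option (Label S)} :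
      Step δ Ω M μ M' → Step δ Ω (.app M N) μ (.app M' N)
  | appR {V N N' : Tm S} {μ : Option (Label S)} :
      Value V → Step δ Ω N μ N' → Step δ Ω (.app V N) μ (.app V N')
  | recordCtx {n : ℕ} {ls : Fin n → ℕ} {Ms : Fin n → Tm S} {μ : Option (Label S)} {N : Tm S}
      (i : Fin n) : (∀ j, j < i → Value (Ms j)) → Step δ Ω (Ms i) μ N →
      Step δ Ω (.record n ls Ms) μ (.record n ls (Function.update Ms i N))
  | projCtx {M M' : Tm S} {l : ℕ} {μ : Option (Label S)} :
      Step δ Ω M μ M' → Step δ Ω (.proj M l) μ (.proj M' l)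
  | singleCtx {M M' : Tm S} {μ : Option (Label S)} :
      Step δ Ω M μ M' → Step δ Ω (.single M) μ (.single M')
  | unionL {M M' N : Tm S} {μ : Option (Label S)} :
      (∀ V, Value V → M ≠ .single V) → Step δ Ω M μ M' → Step δ Ω (.union M N) μ (.union M' N)
  | unionRSingle {V N N' : Tm S} {μ : Option (Label S)} :
      Value V → Step δ Ω N μ N' → Step δ Ω (.union (.single V) N) μ (.union (.single V) N')
  | unionRValue {V N N' : Tm S} {μ : Option (Label S)} :
      Value V → Step δ Ω N μ N' → Step δ Ω (.union V N) μ (.union V N')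
  | forCtx {A : Ty S.Base} {M M' N : Tm S} {μ : Option (Label S)} :
      Step δ Ω M μ M' → Step δ Ω (.for A M N) μ (.for A M' N)
  | iteCtx {L L' M : Tm S} {μ : Option (Label S)} :
      Step δ Ω L μ L' → Step δ Ω (.ite L M) μ (.ite L' M)
  | foldCtx {L L' M N : Tm S} {μ : Option (Label S)} :
      Step δ Ω L μ L' → Step δ Ω (.fold L M N) μ (.fold L' M N)

/-! ## The doubling translation -/

/-- Doubling of types: an `any`-function type becomes the type of pairs of a `pl`-function and a
`db`-function. -/
def Ty.dup {B : Type} : Ty B → Ty B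
  | .base O => .base O
  | .record n ls As => .record n ls (fun i => (As i).dup)
  | .bag A => .bag A.dup
  | .arrow A (.ground X) A' => .arrow A.dup (.ground X) A'.dup
  | .arrow A .any A' =>
      .record 2 ![1, 2] ![.arrow A.dup .pl A'.dup, .arrow A.dup .db A'.dup]

/-- Doubling of terms with respect to the target effect `X`, by recursion on the typing derivation;
it is meant for derivations of `Γ ⊢ M : A ! E` with `E ≤ X`, a condition that all recursive calls
preserve. -/
def Typed.dup {S : Signature} {Γ : List (Ty S.Base)} {M : Tm S} {A : Ty S.Base} {E : Eff} :
    Typed Γ M A E → Ground → Tm S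
  | .var (x := x) _, _ => .var x
  | .const (c := c) _, _ => .const c
  | .op (o := o) ds _, X => .op o (fun i => (ds i).dup X)
  | .lam (A := A) (E := .ground Y) d, _ => .lam (.ground Y) A.dup (d.dup Y)
  | .lam (A := A) (E := .any) d, _ =>
      Tm.pair (.lam .pl A.dup (d.dup .pl)) (.lam .db A.dup (d.dup .db))
  | .app (E' := .ground _) d e _, X => .app (d.dup X) (e.dup X)
  | .app (E' := .any) d e _, .pl => .app (.proj (d.dup .pl) 1) (e.dup .pl)
  | .app (E' := .any) d e _, .db => .app (.proj (d.dup .db) 2) (e.dup .db)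
  | .ite d e, X => .ite (d.dup X) (e.dup X)
  | .record (n := n) (ls := ls) _ ds, X => .record n ls (fun i => (ds i).dup X)
  | .proj (l := l) _ d _ _, X => .proj (d.dup X) l
  | .empty, _ => .empty
  | .single d, X => .single (d.dup X)
  | .union d e, X => .union (d.dup X) (e.dup X)
  | .for (A := A) d e, X => .for A.dup (d.dup X) (e.dup X)
  | .table (t := t), _ => .table t
  | .query d, _ => .query (d.dup .db)
  | .recFn (A := A) (B := B) d, _ => .recFn A.dup B.dup (d.dup .pl)
  | .fold d e f, _ => .fold (d.dup .pl) (e.dup .pl) (f.dup .pl)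

end EffLang

/-! The translation changes only the evaluation of `any`-functions: their values become pairs of a
`pl`-copy and a `db`-copy, and an application first projects the copy it needs. Evaluation at `pl`
therefore takes extra silent steps, and query normalisation takes extra stage 1 steps. Neither can
be seen in a trace, provided that the emitted queries are literally the same terms.

Relations between source and translated terms replace the function `Typed.dup`, because its graph is
not closed under reduction. `RelP` (for `pl`) and `RelQ` (for `db`) also contain the intermediate
states in which the projection has been taken but the source redex has not yet fired (`appLam`).
They carry the typing information of the source that reduction needs, so that preservation of the
relation includes subject reduction. `Typed.related_dup` shows that a term is related to its
translation.

The core is the treatment of queries. `RelQ` is a simulation in both directions for many-step stage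
1 rewriting (`RelQ.simulates`, `RelQ.simulated`). A subformula argument (`RelQ.normal`) shows that
related terms of function-free type, in a function-free context, coincide as soon as one of them is
stage 1 normal. Hence related queries have the same stage 1 normal forms, and so the same values of
|·| (`RelQ.normalises_iff`). Neither termination nor confluence of the rewriting is used.

For evaluation, `RelP` is a weak simulation in both directions (`RelP.answers`, `RelP.answered`). A
response needs its own argument: the normalised query is well typed, so the response is a value of
flat type, and such values are related to themselves. Finally, weak simulation implies inclusion of
traces (`IsSimulation.Tr_subset`). Divergence is harmless because a run that is eventually silent
has the same trace as one of its finite prefixes. -/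

namespace EffLang

/-! ## Traces and simulations -/

section Traces

variable {X Y L : Type} {step : X → Option L → X → Prop} {stepY : Y → Option L → Y → Prop}

/-- `x ⟹ y` for the silent label, `x ⟹μ y` for a visible label `μ`. -/
def HatWeak (step : X → Option L → X → Prop) (x : X) : Option L → X → Prop
  | none, y => Silent step x y
  | some l, y => Weak step x (some l) y

/-- Runs of visible weak transitions, followed by silent transitions. -/
inductive VisRun (step : X → Option L → X → Prop) : X → List L → X → Prop
  | nil {x y : X} : Silent step x y → VisRun step x [] y
  | cons {x y z : X} {l : L} {w : List L} :
      Weak step x (some l) y → VisRun step y w z → VisRun step x (l :: w) z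

/-! ### Reduction of runs to their visible labels -/

theorem Weak.silent_left {x y z : X} {μ : Option L} (h : Silent step x y) (h' : Weak step y μ z) :
    Weak step x μ z := by
  obtain ⟨a, b, h₁, h₂, h₃⟩ := h'
  exact ⟨a, b, h.trans h₁, h₂, h₃⟩

theorem Weak.silent_right {x y z : X} {μ : Option L} (h : Weak step x μ y)
    (h' : Silent step y z) : Weak step x μ z := by
  obtain ⟨a, b, h₁, h₂, h₃⟩ := h
  exact ⟨a, b, h₁, h₂, h₃.trans h'⟩

theorem Weak.silent {x y : X} (h : Weak step x none y) : Silent step x y := by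
  obtain ⟨a, b, h₁, h₂, h₃⟩ := h
  exact h₁.trans (.head h₂ h₃)

theorem VisRun.silent_left {x y z : X} {w : List L} (h : Silent step x y)
    (h' : VisRun step y w z) : VisRun step x w z := by
  cases h' with
  | nil h₁ => exact .nil (h.trans h₁)
  | cons h₁ h₂ => exact .cons (h₁.silent_left h) h₂

theorem FinRun.visRun {x y : X} {μs : List (Option L)} (h : FinRun step x μs y) :
    VisRun step x μs.reduceOption y := by
  induction h with
  | nil x => exact .nil .refl
  | @cons x y z μ μs h₁ h₂ ih =>
    cases μ with
    | none => exact ih.silent_left h₁.silent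
    | some l => exact .cons h₁ ih

theorem VisRun.finRun {x y : X} {w : List L} (h : VisRun step x w y) :
    ∃ z, FinRun step x (w.map some) z := by
  induction h with
  | nil h => exact ⟨_, .nil _⟩
  | cons h₁ h₂ ih => exact ih.imp fun z hz => .cons h₁ hz

theorem finRun_of_seq {xs : ℕ → X} {μ : ℕ → Option L}
    (h : ∀ n, Weak step (xs n) (μ n) (xs (n + 1))) (n k : ℕ) :
    FinRun step (xs k) ((List.range n).map fun i => μ (k + i)) (xs (k + n)) := by
  induction n generalizing k with
  | zero => exact .nil _
  | succ n ih =>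
    rw [List.range_succ_eq_map, List.map_cons, List.map_map]
    refine .cons (h k) ?_
    have := ih (k + 1)
    rw [show k + 1 + n = k + (n + 1) by omega] at this
    convert this using 3
    simp only [Function.comp_apply, Nat.succ_eq_add_one]
    congr 1
    omega

theorem silent_of_seq {xs : ℕ → X} {μ : ℕ → Option L}
    (h : ∀ n, Weak step (xs n) (μ n) (xs (n + 1))) {a b : ℕ} (hab : a ≤ b)
    (hμ : ∀ m, a ≤ m → m < b → μ m = none) : Silent step (xs a) (xs b) := by
  induction b, hab using Nat.le_induction with
  | base => exact .refl
  | succ b hb ih =>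
    have hw := h b
    rw [hμ b hb (by omega)] at hw
    exact (ih fun m h₁ h₂ => hμ m h₁ (by omega)).trans hw.silent

/-- Silent transitions can be absorbed into neighbouring weak transitions, and an infinite run with
a finite trace can be cut off after its last visible label. -/
theorem mem_Tr_fin {x : X} {w : List L} :
    Word.fin w ∈ Tr step x ↔ ∃ y, VisRun step x w y := by
  constructor
  · rintro (⟨μs, y, h, hw⟩ | ⟨xs, μ, rfl, h, n, -, hw⟩)
    · cases hw
      exact ⟨y, h.visRun⟩
    · have := (finRun_of_seq h n 0).visRun
      simp only [Nat.zero_add] at this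
      exact ⟨_, hw ▸ this⟩
  · rintro ⟨y, h⟩
    obtain ⟨z, hz⟩ := h.finRun
    refine Or.inl ⟨_, z, hz, ?_⟩
    congr 1
    simp [List.reduceOption]

/-- An infinite trace leaves only finitely many silent labels between consecutive visible ones, so
the run can be regrouped into visible weak transitions. -/
theorem mem_Tr_inf {x : X} {w : ℕ → L} :
    Word.inf w ∈ Tr step x ↔
      ∃ xs : ℕ → X, xs 0 = x ∧ ∀ k, Weak step (xs k) (some (w k)) (xs (k + 1)) := by
  constructor
  · rintro (⟨μs, y, h, hw⟩ | ⟨xs, μ, rfl, h, φ, hφ, hw, hs⟩)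
    · cases hw
    -- After the initial state, the regrouped run keeps only the states directly following a visible
    -- label. The labels skipped are silent because every visible position lies in the range of `φ`.
    · refine ⟨fun k => k.casesOn (xs 0) (fun k => xs (φ k + 1)), rfl, fun k => ?_⟩
      have hk := h (φ k)
      rw [hw k] at hk
      cases k with
      | zero =>
        refine hk.silent_left (silent_of_seq h (Nat.zero_le _) fun m _ hm => ?_)
        by_contra hne
        obtain ⟨j, rfl⟩ := hs m hne
        exact absurd (hφ.lt_iff_lt.mp hm) (Nat.not_lt_zero _)
      | succ k =>
        refine hk.silent_left (silent_of_seq h (hφ (Nat.lt_succ_self k)) fun m hm hm' => ?_)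
        by_contra hne
        obtain ⟨j, rfl⟩ := hs m hne
        have h₁ := hφ.lt_iff_lt.mp hm'
        have h₂ := hφ.lt_iff_lt.mp hm
        omega
  · rintro ⟨xs, hx, h⟩
    exact Or.inr ⟨xs, fun k => some (w k), hx, h, id, strictMono_id, fun _ => rfl,
      fun m _ => ⟨m, rfl⟩⟩

/-- `R` is a weak simulation of `step` by `stepY`. -/
def IsSimulation (step : X → Option L → X → Prop) (stepY : Y → Option L → Y → Prop)
    (R : X → Y → Prop) : Prop :=
  ∀ x y μ x', R x y → step x μ x' → ∃ y', HatWeak stepY y μ y' ∧ R x' y'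

theorem IsSimulation.silent {R : X → Y → Prop} (hR : IsSimulation step stepY R) {x x' : X} {y : Y}
    (hxy : R x y) (h : Silent step x x') : ∃ y', Silent stepY y y' ∧ R x' y' := by
  induction h with
  | refl => exact ⟨y, .refl, hxy⟩
  | tail _ h₂ ih =>
    obtain ⟨y₁, h₁, hR₁⟩ := ih
    obtain ⟨y₂, h₂, hR₂⟩ := hR _ _ _ _ hR₁ h₂
    exact ⟨y₂, Relation.ReflTransGen.trans h₁ h₂, hR₂⟩

theorem IsSimulation.weak {R : X → Y → Prop} (hR : IsSimulation step stepY R) {x x' : X} {y : Y}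
    {l : L} (hxy : R x y) (h : Weak step x (some l) x') :
    ∃ y', Weak stepY y (some l) y' ∧ R x' y' := by
  obtain ⟨a, b, h₁, h₂, h₃⟩ := h
  obtain ⟨y₁, k₁, r₁⟩ := hR.silent hxy h₁
  obtain ⟨y₂, k₂, r₂⟩ := hR _ _ _ _ r₁ h₂
  obtain ⟨y₃, k₃, r₃⟩ := hR.silent r₂ h₃
  exact ⟨y₃, (Weak.silent_left k₁ k₂).silent_right k₃, r₃⟩

theorem IsSimulation.visRun {R : X → Y → Prop} (hR : IsSimulation step stepY R) {x x' : X}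
    {w : List L} (h : VisRun step x w x') {y : Y} (hxy : R x y) :
    ∃ y', VisRun stepY y w y' := by
  induction h generalizing y with
  | nil h =>
    obtain ⟨y', h', -⟩ := hR.silent hxy h
    exact ⟨y', .nil h'⟩
  | cons h₁ _ ih =>
    obtain ⟨y₁, k₁, r₁⟩ := hR.weak hxy h₁
    obtain ⟨y₂, k₂⟩ := ih r₁
    exact ⟨y₂, .cons k₁ k₂⟩

/-- By the two characterisations above, only visible weak transitions need to be matched. For
infinite traces the matching run is built by recursion on the index, choosing each next state
together with the proof that it is related. -/
theorem IsSimulation.Tr_subset {R : X → Y → Prop} (hR : IsSimulation step stepY R) {x : X} {y : Y}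
    (hxy : R x y) : Tr step x ⊆ Tr stepY y := by
  rintro (w | w) hw
  · rw [mem_Tr_fin] at hw ⊢
    obtain ⟨x', h⟩ := hw
    exact hR.visRun h hxy
  · rw [mem_Tr_inf] at hw ⊢
    obtain ⟨xs, rfl, h⟩ := hw
    have next : ∀ k (y : {y // R (xs k) y}), ∃ y' : {y // R (xs (k + 1)) y},
        Weak stepY y.1 (some (w k)) y'.1 := fun k y => by
      obtain ⟨y', h₁, h₂⟩ := hR.weak y.2 (h k)
      exact ⟨⟨y', h₂⟩, h₁⟩
    choose f hf using next
    let ys : (k : ℕ) → {y // R (xs k) y} := fun k => k.rec ⟨y, hxy⟩ f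
    exact ⟨fun k => (ys k).1, rfl, fun k => hf k (ys k)⟩

end Traces

/-! ## The translation as a relation -/

variable {S : Signature}

/-- `RelQ Γ M A M'`: `M` has type `A` at effect `db`, and `M'` translates `M` at `db`, up to
projections from translated `any`-functions and up to the parts that cannot be reached at
`db`. -/
inductive RelQ : List (Ty S.Base) → Tm S → Ty S.Base → Tm S → Prop
  | var {Γ : List (Ty S.Base)} {x : ℕ} {A : Ty S.Base} :
      Γ[x]? = some A → RelQ Γ (.var x) A (.var x)
  | const {Γ : List (Ty S.Base)} {c : S.Const} {O : S.Base} :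
      S.constTy c = O → RelQ Γ (.const c) (.base O) (.const c)
  | op {Γ : List (Ty S.Base)} {o : S.Op} {Ms Ms' : Fin (S.arity o) → Tm S} {O : S.Base} :
      (∀ i, RelQ Γ (Ms i) (.base (S.opDom o i)) (Ms' i)) → S.opCod o = O →
      RelQ Γ (.op o Ms) (.base O) (.op o Ms')
  -- The bodies are unconstrained, as they are in `recFn` below: a `pl`-function cannot be applied
  -- at `db`, but rewriting acts inside it. Forgetting its body lets such steps be answered by no
  -- step at all.
  | lamPl {Γ : List (Ty S.Base)} {M M' : Tm S} {A A' B : Ty S.Base} :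
      RelQ Γ (.lam .pl A M) (.arrow A .pl B) (.lam .pl A' M')
  | lamDb {Γ : List (Ty S.Base)} {M M' : Tm S} {A A' B : Ty S.Base} :
      RelQ (A :: Γ) M B M' → RelQ Γ (.lam .db A M) (.arrow A .db B) (.lam .db A' M')
  -- Only the `db`-copy is constrained, since rewriting may treat the two copies independently. An
  -- equation describes it because renaming, substitution and `Function.update` do not return a
  -- family of the literal form `![_, _]`.
  | lamAny {Γ : List (Ty S.Base)} {M M' : Tm S} {A A' B : Ty S.Base} {Ps : Fin 2 → Tm S} :
      RelQ (A :: Γ) M B M' → Ps 1 = .lam .db A' M' →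
      RelQ Γ (.lam .any A M) (.arrow A .any B) (.record 2 ![1, 2] Ps)
  | appDb {Γ : List (Ty S.Base)} {M M' N N' : Tm S} {A B : Ty S.Base} :
      RelQ Γ M (.arrow A .db B) M' → RelQ Γ N A N' → RelQ Γ (.app M N) B (.app M' N')
  | appAny {Γ : List (Ty S.Base)} {M M' N N' : Tm S} {A B : Ty S.Base} :
      RelQ Γ M (.arrow A .any B) M' → RelQ Γ N A N' →
      RelQ Γ (.app M N) B (.app (.proj M' 2) N')
  -- The state after the projection from the pair, which has no counterpart in the source.
  | appLam {Γ : List (Ty S.Base)} {M M' N N' : Tm S} {A A' B : Ty S.Base} :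
      RelQ (A :: Γ) M B M' → RelQ Γ N A N' →
      RelQ Γ (.app (.lam .any A M) N) B (.app (.lam .db A' M') N')
  | ite {Γ : List (Ty S.Base)} {L L' M M' : Tm S} {A : Ty S.Base} :
      RelQ Γ L (.base S.bool) L' → RelQ Γ M (.bag A) M' →
      RelQ Γ (.ite L M) (.bag A) (.ite L' M')
  | record {Γ : List (Ty S.Base)} {n : ℕ} {ls : Fin n → ℕ} {Ms Ms' : Fin n → Tm S}
      {As : Fin n → Ty S.Base} :
      Function.Injective ls → (∀ i, RelQ Γ (Ms i) (As i) (Ms' i)) →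
      RelQ Γ (.record n ls Ms) (.record n ls As) (.record n ls Ms')
  | proj {Γ : List (Ty S.Base)} {n : ℕ} {ls : Fin n → ℕ} {M M' : Tm S}
      {As : Fin n → Ty S.Base} {l : ℕ} {A : Ty S.Base} (i : Fin n) :
      RelQ Γ M (.record n ls As) M' → ls i = l → As i = A → RelQ Γ (.proj M l) A (.proj M' l)
  | empty {Γ : List (Ty S.Base)} {A : Ty S.Base} : RelQ Γ .empty (.bag A) .empty
  | single {Γ : List (Ty S.Base)} {M M' : Tm S} {A : Ty S.Base} :
      RelQ Γ M A M' → RelQ Γ (.single M) (.bag A) (.single M')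
  | union {Γ : List (Ty S.Base)} {M M' N N' : Tm S} {A : Ty S.Base} :
      RelQ Γ M (.bag A) M' → RelQ Γ N (.bag A) N' →
      RelQ Γ (.union M N) (.bag A) (.union M' N')
  -- The annotation must be exactly `A.dup`: loops survive in the emitted query, and normal forms
  -- are to agree as terms. Annotations of functions, and those of loops in `RelP`, may stay
  -- arbitrary.
  | forIn {Γ : List (Ty S.Base)} {M M' N N' : Tm S} {A B : Ty S.Base} :
      RelQ Γ M (.bag A) M' → RelQ (A :: Γ) N (.bag B) N' →
      RelQ Γ (.for A M N) (.bag B) (.for A.dup M' N')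
  | table {Γ : List (Ty S.Base)} {t : S.Table} :
      RelQ Γ (.table t) (.bag (S.tableRow t).toTy) (.table t)
  | recFn {Γ : List (Ty S.Base)} {M M' : Tm S} {A A' B B' : Ty S.Base} :
      RelQ Γ (.recFn A B M) (.arrow A .pl B) (.recFn A' B' M')

/-- `RelP Γ M A M'`: `M` has type `A` at effect `pl`, and `M'` translates `M` at `pl`, up to
projections from translated `any`-functions and up to the parts that cannot be reached at
`db` within queries. -/
inductive RelP : List (Ty S.Base) → Tm S → Ty S.Base → Tm S → Prop
  | var {Γ : List (Ty S.Base)} {x : ℕ} {A : Ty S.Base} :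
      Γ[x]? = some A → RelP Γ (.var x) A (.var x)
  | const {Γ : List (Ty S.Base)} {c : S.Const} {O : S.Base} :
      S.constTy c = O → RelP Γ (.const c) (.base O) (.const c)
  | op {Γ : List (Ty S.Base)} {o : S.Op} {Ms Ms' : Fin (S.arity o) → Tm S} {O : S.Base} :
      (∀ i, RelP Γ (Ms i) (.base (S.opDom o i)) (Ms' i)) → S.opCod o = O →
      RelP Γ (.op o Ms) (.base O) (.op o Ms')
  | lamPl {Γ : List (Ty S.Base)} {M M' : Tm S} {A A' B : Ty S.Base} :
      RelP (A :: Γ) M B M' → RelP Γ (.lam .pl A M) (.arrow A .pl B) (.lam .pl A' M')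
  | lamDb {Γ : List (Ty S.Base)} {M M' : Tm S} {A A' B : Ty S.Base} :
      RelQ (A :: Γ) M B M' → RelP Γ (.lam .db A M) (.arrow A .db B) (.lam .db A' M')
  | lamAny {Γ : List (Ty S.Base)} {M M₁ M₂ : Tm S} {A A₁ A₂ B : Ty S.Base} {Ps : Fin 2 → Tm S} :
      RelP (A :: Γ) M B M₁ → RelQ (A :: Γ) M B M₂ →
      Ps 0 = .lam .pl A₁ M₁ → Ps 1 = .lam .db A₂ M₂ →
      RelP Γ (.lam .any A M) (.arrow A .any B) (.record 2 ![1, 2] Ps)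
  | appPl {Γ : List (Ty S.Base)} {M M' N N' : Tm S} {A B : Ty S.Base} :
      RelP Γ M (.arrow A .pl B) M' → RelP Γ N A N' → RelP Γ (.app M N) B (.app M' N')
  | appAny {Γ : List (Ty S.Base)} {M M' N N' : Tm S} {A B : Ty S.Base} :
      RelP Γ M (.arrow A .any B) M' → RelP Γ N A N' →
      RelP Γ (.app M N) B (.app (.proj M' 1) N')
  | appLam {Γ : List (Ty S.Base)} {M M' N N' : Tm S} {A A' B : Ty S.Base} :
      RelP (A :: Γ) M B M' → RelP Γ N A N' →
      RelP Γ (.app (.lam .any A M) N) B (.app (.lam .pl A' M') N')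
  | ite {Γ : List (Ty S.Base)} {L L' M M' : Tm S} {A : Ty S.Base} :
      RelP Γ L (.base S.bool) L' → RelP Γ M (.bag A) M' →
      RelP Γ (.ite L M) (.bag A) (.ite L' M')
  | record {Γ : List (Ty S.Base)} {n : ℕ} {ls : Fin n → ℕ} {Ms Ms' : Fin n → Tm S}
      {As : Fin n → Ty S.Base} :
      Function.Injective ls → (∀ i, RelP Γ (Ms i) (As i) (Ms' i)) →
      RelP Γ (.record n ls Ms) (.record n ls As) (.record n ls Ms')
  | proj {Γ : List (Ty S.Base)} {n : ℕ} {ls : Fin n → ℕ} {M M' : Tm S}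
      {As : Fin n → Ty S.Base} {l : ℕ} {A : Ty S.Base} (i : Fin n) :
      RelP Γ M (.record n ls As) M' → ls i = l → As i = A → RelP Γ (.proj M l) A (.proj M' l)
  | empty {Γ : List (Ty S.Base)} {A : Ty S.Base} : RelP Γ .empty (.bag A) .empty
  | single {Γ : List (Ty S.Base)} {M M' : Tm S} {A : Ty S.Base} :
      RelP Γ M A M' → RelP Γ (.single M) (.bag A) (.single M')
  | union {Γ : List (Ty S.Base)} {M M' N N' : Tm S} {A : Ty S.Base} :
      RelP Γ M (.bag A) M' → RelP Γ N (.bag A) N' →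
      RelP Γ (.union M N) (.bag A) (.union M' N')
  | forIn {Γ : List (Ty S.Base)} {M M' N N' : Tm S} {A A' B : Ty S.Base} :
      RelP Γ M (.bag A) M' → RelP (A :: Γ) N (.bag B) N' →
      RelP Γ (.for A M N) (.bag B) (.for A' M' N')
  | query {Γ : List (Ty S.Base)} {M M' : Tm S} {R : Row S.Base} :
      RelQ Γ M (.bag R.toTy) M' → RelP Γ (.query M) (.bag R.toTy) (.query M')
  | recFn {Γ : List (Ty S.Base)} {M M' : Tm S} {A A' B B' : Ty S.Base} :
      RelP (A :: .arrow A .pl B :: Γ) M B M' →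
      RelP Γ (.recFn A B M) (.arrow A .pl B) (.recFn A' B' M')
  | fold {Γ : List (Ty S.Base)} {L L' M M' N N' : Tm S} {A B : Ty S.Base} :
      RelP Γ L (.bag A) L' → RelP Γ M B M' →
      RelP Γ N (.arrow A .pl (.arrow B .pl B)) N' → RelP Γ (.fold L M N) B (.fold L' M' N')

/-! ### Renaming and substitution -/

/-- The renaming `ξ` takes variables of the context `Γ` to variables of `Δ` of the same type. -/
def RenTyped {B : Type} (Γ Δ : List (Ty B)) (ξ : ℕ → ℕ) : Prop :=
  ∀ x A, Γ[x]? = some A → Δ[ξ x]? = some A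

theorem RenTyped.up {B : Type} {Γ Δ : List (Ty B)} {ξ : ℕ → ℕ} (h : RenTyped Γ Δ ξ) (A : Ty B) :
    RenTyped (A :: Γ) (A :: Δ) (upRen ξ)
  | 0, _, hx => hx
  | x + 1, C, hx => h x C hx

theorem RenTyped.succ {B : Type} (Γ : List (Ty B)) (A : Ty B) : RenTyped Γ (A :: Γ) Nat.succ :=
  fun _ _ hx => hx

theorem RelQ.rename {Γ Δ : List (Ty S.Base)} {M M' : Tm S} {A : Ty S.Base} {ξ : ℕ → ℕ}
    (h : RelQ Γ M A M') (hξ : RenTyped Γ Δ ξ) : RelQ Δ (M.rename ξ) A (M'.rename ξ) := by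
  induction h generalizing Δ ξ with
  | var h => exact .var (hξ _ _ h)
  | const h => exact .const h
  | op _ h ih => exact .op (fun i => ih i hξ) h
  | lamPl => exact .lamPl
  | lamDb _ ih => exact .lamDb (ih (hξ.up _))
  | lamAny _ h ih => exact .lamAny (ih (hξ.up _)) (by simp only [h, Tm.rename]; rfl)
  | appDb _ _ ih₁ ih₂ => exact .appDb (ih₁ hξ) (ih₂ hξ)
  | appAny _ _ ih₁ ih₂ => exact .appAny (ih₁ hξ) (ih₂ hξ)
  | appLam _ _ ih₁ ih₂ => exact .appLam (ih₁ (hξ.up _)) (ih₂ hξ)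
  | ite _ _ ih₁ ih₂ => exact .ite (ih₁ hξ) (ih₂ hξ)
  | record h _ ih => exact .record h fun i => ih i hξ
  | proj i _ h₁ h₂ ih => exact .proj i (ih hξ) h₁ h₂
  | empty => exact .empty
  | single _ ih => exact .single (ih hξ)
  | union _ _ ih₁ ih₂ => exact .union (ih₁ hξ) (ih₂ hξ)
  | forIn _ _ ih₁ ih₂ => exact .forIn (ih₁ hξ) (ih₂ (hξ.up _))
  | table => exact .table
  | recFn => exact .recFn

theorem RelP.rename {Γ Δ : List (Ty S.Base)} {M M' : Tm S} {A : Ty S.Base} {ξ : ℕ → ℕ}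
    (h : RelP Γ M A M') (hξ : RenTyped Γ Δ ξ) : RelP Δ (M.rename ξ) A (M'.rename ξ) := by
  induction h generalizing Δ ξ with
  | var h => exact .var (hξ _ _ h)
  | const h => exact .const h
  | op _ h ih => exact .op (fun i => ih i hξ) h
  | lamPl _ ih => exact .lamPl (ih (hξ.up _))
  | lamDb h => exact .lamDb (h.rename (hξ.up _))
  | lamAny _ hq h₀ h₁ ih =>
    exact .lamAny (ih (hξ.up _)) (hq.rename (hξ.up _)) (by simp only [h₀, Tm.rename]; rfl)
      (by simp only [h₁, Tm.rename]; rfl)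
  | appPl _ _ ih₁ ih₂ => exact .appPl (ih₁ hξ) (ih₂ hξ)
  | appAny _ _ ih₁ ih₂ => exact .appAny (ih₁ hξ) (ih₂ hξ)
  | appLam _ _ ih₁ ih₂ => exact .appLam (ih₁ (hξ.up _)) (ih₂ hξ)
  | ite _ _ ih₁ ih₂ => exact .ite (ih₁ hξ) (ih₂ hξ)
  | record h _ ih => exact .record h fun i => ih i hξ
  | proj i _ h₁ h₂ ih => exact .proj i (ih hξ) h₁ h₂
  | empty => exact .empty
  | single _ ih => exact .single (ih hξ)
  | union _ _ ih₁ ih₂ => exact .union (ih₁ hξ) (ih₂ hξ)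
  | forIn _ _ ih₁ ih₂ => exact .forIn (ih₁ hξ) (ih₂ (hξ.up _))
  | query h => exact .query (h.rename hξ)
  | recFn _ ih => exact .recFn (ih ((hξ.up _).up _))
  | fold _ _ _ ih₁ ih₂ ih₃ => exact .fold (ih₁ hξ) (ih₂ hξ) (ih₃ hξ)

/-- The substitutions `σ` and `σ'` of terms over `Δ` for the variables of `Γ` are pointwise
related. -/
def SubRelated (R : List (Ty S.Base) → Tm S → Ty S.Base → Tm S → Prop) (Γ Δ : List (Ty S.Base))
    (σ σ' : ℕ → Tm S) : Prop :=
  ∀ x A, Γ[x]? = some A → R Δ (σ x) A (σ' x)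

theorem SubRelated.upQ {Γ Δ : List (Ty S.Base)} {σ σ' : ℕ → Tm S}
    (h : SubRelated RelQ Γ Δ σ σ') (A : Ty S.Base) :
    SubRelated RelQ (A :: Γ) (A :: Δ) (Tm.upSub σ) (Tm.upSub σ')
  | 0, _, hx => .var hx
  | x + 1, C, hx => (h x C hx).rename (.succ Δ A)

theorem SubRelated.upP {Γ Δ : List (Ty S.Base)} {σ σ' : ℕ → Tm S}
    (h : SubRelated RelP Γ Δ σ σ') (A : Ty S.Base) :
    SubRelated RelP (A :: Γ) (A :: Δ) (Tm.upSub σ) (Tm.upSub σ')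
  | 0, _, hx => .var hx
  | x + 1, C, hx => (h x C hx).rename (.succ Δ A)

theorem RelQ.subst {Γ Δ : List (Ty S.Base)} {M M' : Tm S} {A : Ty S.Base} {σ σ' : ℕ → Tm S}
    (h : RelQ Γ M A M') (hσ : SubRelated RelQ Γ Δ σ σ') : RelQ Δ (M.subst σ) A (M'.subst σ') := by
  induction h generalizing Δ σ σ' with
  | var h => exact hσ _ _ h
  | const h => exact .const h
  | op _ h ih => exact .op (fun i => ih i hσ) h
  | lamPl => exact .lamPl
  | lamDb _ ih => exact .lamDb (ih (hσ.upQ _))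
  | lamAny _ h ih => exact .lamAny (ih (hσ.upQ _)) (by simp only [h, Tm.subst]; rfl)
  | appDb _ _ ih₁ ih₂ => exact .appDb (ih₁ hσ) (ih₂ hσ)
  | appAny _ _ ih₁ ih₂ => exact .appAny (ih₁ hσ) (ih₂ hσ)
  | appLam _ _ ih₁ ih₂ => exact .appLam (ih₁ (hσ.upQ _)) (ih₂ hσ)
  | ite _ _ ih₁ ih₂ => exact .ite (ih₁ hσ) (ih₂ hσ)
  | record h _ ih => exact .record h fun i => ih i hσ
  | proj i _ h₁ h₂ ih => exact .proj i (ih hσ) h₁ h₂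
  | empty => exact .empty
  | single _ ih => exact .single (ih hσ)
  | union _ _ ih₁ ih₂ => exact .union (ih₁ hσ) (ih₂ hσ)
  | forIn _ _ ih₁ ih₂ => exact .forIn (ih₁ hσ) (ih₂ (hσ.upQ _))
  | table => exact .table
  | recFn => exact .recFn

/-- The substituted terms must be related at both effects, since a variable may also occur in a
query or in the body of a `db`- or `any`-function. -/
theorem RelP.subst {Γ Δ : List (Ty S.Base)} {M M' : Tm S} {A : Ty S.Base} {σ σ' : ℕ → Tm S}
    (h : RelP Γ M A M') (hσ : SubRelated RelP Γ Δ σ σ') (hq : SubRelated RelQ Γ Δ σ σ') :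
    RelP Δ (M.subst σ) A (M'.subst σ') := by
  induction h generalizing Δ σ σ' with
  | var h => exact hσ _ _ h
  | const h => exact .const h
  | op _ h ih => exact .op (fun i => ih i hσ hq) h
  | lamPl _ ih => exact .lamPl (ih (hσ.upP _) (hq.upQ _))
  | lamDb h => exact .lamDb (h.subst (hq.upQ _))
  | lamAny _ h h₀ h₁ ih =>
    exact .lamAny (ih (hσ.upP _) (hq.upQ _)) (h.subst (hq.upQ _))
      (by simp only [h₀, Tm.subst]; rfl) (by simp only [h₁, Tm.subst]; rfl)
  | appPl _ _ ih₁ ih₂ => exact .appPl (ih₁ hσ hq) (ih₂ hσ hq)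
  | appAny _ _ ih₁ ih₂ => exact .appAny (ih₁ hσ hq) (ih₂ hσ hq)
  | appLam _ _ ih₁ ih₂ => exact .appLam (ih₁ (hσ.upP _) (hq.upQ _)) (ih₂ hσ hq)
  | ite _ _ ih₁ ih₂ => exact .ite (ih₁ hσ hq) (ih₂ hσ hq)
  | record h _ ih => exact .record h fun i => ih i hσ hq
  | proj i _ h₁ h₂ ih => exact .proj i (ih hσ hq) h₁ h₂
  | empty => exact .empty
  | single _ ih => exact .single (ih hσ hq)
  | union _ _ ih₁ ih₂ => exact .union (ih₁ hσ hq) (ih₂ hσ hq)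
  | forIn _ _ ih₁ ih₂ => exact .forIn (ih₁ hσ hq) (ih₂ (hσ.upP _) (hq.upQ _))
  | query h => exact .query (h.subst hq)
  | recFn _ ih => exact .recFn (ih ((hσ.upP _).upP _) ((hq.upQ _).upQ _))
  | fold _ _ _ ih₁ ih₂ ih₃ => exact .fold (ih₁ hσ hq) (ih₂ hσ hq) (ih₃ hσ hq)

theorem RelQ.inst {Γ : List (Ty S.Base)} {M M' N N' : Tm S} {A B : Ty S.Base}
    (h : RelQ (A :: Γ) M B M') (hN : RelQ Γ N A N') : RelQ Γ (M.inst N) B (M'.inst N') := by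
  refine h.subst ?_
  rintro (_ | x) C hx
  · cases hx
    exact hN
  · exact .var hx

theorem RelP.inst {Γ : List (Ty S.Base)} {M M' N N' : Tm S} {A B : Ty S.Base}
    (h : RelP (A :: Γ) M B M') (hN : RelP Γ N A N') (hNq : RelQ Γ N A N') :
    RelP Γ (M.inst N) B (M'.inst N') := by
  refine h.subst ?_ ?_
  · rintro (_ | x) C hx
    · cases hx
      exact hN
    · exact .var hx
  · rintro (_ | x) C hx
    · cases hx
      exact hNq
    · exact .var hx

theorem RelP.inst₂ {Γ : List (Ty S.Base)} {M M' N N' F F' : Tm S} {A B C : Ty S.Base}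
    (h : RelP (A :: C :: Γ) M B M') (hN : RelP Γ N A N') (hNq : RelQ Γ N A N')
    (hF : RelP Γ F C F') (hFq : RelQ Γ F C F') : RelP Γ (M.inst₂ N F) B (M'.inst₂ N' F') := by
  refine h.subst ?_ ?_
  · rintro (_ | _ | x) D hx
    · cases hx
      exact hN
    · cases hx
      exact hF
    · exact .var hx
  · rintro (_ | _ | x) D hx
    · cases hx
      exact hNq
    · cases hx
      exact hFq
    · exact .var hx

/-! ### The translation of a derivation -/

/-- The two effects must be treated together: an `any`-abstraction needs both translations of its
body, and `query` passes from `pl` to `db`. -/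
theorem Typed.related_dup {Γ : List (Ty S.Base)} {M : Tm S} {A : Ty S.Base} {E : Eff}
    (d : Typed Γ M A E) :
    (Eff.Sub E .pl → RelP Γ M A (d.dup .pl)) ∧ (Eff.Sub E .db → RelQ Γ M A (d.dup .db)) := by
  induction d with
  | var h => exact ⟨fun _ => .var h, fun _ => .var h⟩
  | const h => exact ⟨fun _ => .const h, fun _ => .const h⟩
  | op _ h ih => exact ⟨fun s => .op (fun i => (ih i).1 s) h, fun s => .op (fun i => (ih i).2 s) h⟩
  | @lam _ _ _ _ E _ _ ih =>
    rcases E with (_ | _) | _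
    · exact ⟨fun _ => .lamPl (ih.1 (.refl _)), fun _ => .lamPl⟩
    · exact ⟨fun _ => .lamDb (ih.2 (.refl _)), fun _ => .lamDb (ih.2 (.refl _))⟩
    · exact ⟨fun _ => .lamAny (ih.1 .anyPl) (ih.2 .anyDb) rfl rfl,
        fun _ => .lamAny (ih.2 .anyDb) rfl⟩
  | @app _ _ _ _ _ _ E' _ _ hs ih₁ ih₂ =>
    rcases E' with Y | _
    -- A ground effect is below no effect but itself, so the function, the application and the
    -- target all have the same effect.
    · cases hs
      constructor
      · intro s
        cases s
        exact .appPl (ih₁.1 (.refl _)) (ih₂.1 (.refl _))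
      · intro s
        cases s
        exact .appDb (ih₁.2 (.refl _)) (ih₂.2 (.refl _))
    · exact ⟨fun s => .appAny (ih₁.1 s) (ih₂.1 s), fun s => .appAny (ih₁.2 s) (ih₂.2 s)⟩
  | ite _ _ ih₁ ih₂ =>
    exact ⟨fun s => .ite (ih₁.1 s) (ih₂.1 s), fun s => .ite (ih₁.2 s) (ih₂.2 s)⟩
  | record h _ ih =>
    exact ⟨fun s => .record h fun i => (ih i).1 s, fun s => .record h fun i => (ih i).2 s⟩
  | proj i _ h₁ h₂ ih =>
    exact ⟨fun s => .proj i (ih.1 s) h₁ h₂, fun s => .proj i (ih.2 s) h₁ h₂⟩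
  | empty => exact ⟨fun _ => .empty, fun _ => .empty⟩
  | single _ ih => exact ⟨fun s => .single (ih.1 s), fun s => .single (ih.2 s)⟩
  | union _ _ ih₁ ih₂ =>
    exact ⟨fun s => .union (ih₁.1 s) (ih₂.1 s), fun s => .union (ih₁.2 s) (ih₂.2 s)⟩
  | table => exact ⟨nofun, fun _ => .table⟩
  | query _ ih => exact ⟨fun _ => .query (ih.2 (.refl _)), nofun⟩
  | recFn _ ih => exact ⟨fun _ => .recFn (ih.1 (.refl _)), fun _ => .recFn⟩
  | fold _ _ _ ih₁ ih₂ ih₃ =>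
    exact ⟨fun _ => .fold (ih₁.1 (.refl _)) (ih₂.1 (.refl _)) (ih₃.1 (.refl _)), nofun⟩
  -- The one remaining constructor is `for`.
  | _ _ _ ih₁ ih₂ =>
    exact ⟨fun s => .forIn (ih₁.1 s) (ih₂.1 s), fun s => .forIn (ih₁.2 s) (ih₂.2 s)⟩

/-! ## Normalisation of related queries -/

/-- Finitely many rewriting steps. -/
abbrev Rewrites (R : Tm S → Tm S → Prop) : Tm S → Tm S → Prop :=
  Relation.ReflTransGen (Compat R)

/-! ### Matching of stage 1 rewriting steps -/

theorem Rewrites.op {R : Tm S → Tm S → Prop} {o : S.Op} {Ms : Fin (S.arity o) → Tm S}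
    {i : Fin (S.arity o)} {N : Tm S} (h : Rewrites R (Ms i) N) :
    Rewrites R (.op o Ms) (.op o (Function.update Ms i N)) := by
  have := Relation.ReflTransGen.lift (fun N => Tm.op o (Function.update Ms i N)) (p := Compat R)
    (fun a b hab => by
      have := Compat.op (Ms := Function.update Ms i a) i (by simpa using hab)
      simpa using this) _ _ h
  simpa [Function.onFun] using this

theorem Rewrites.record {R : Tm S → Tm S → Prop} {n : ℕ} {ls : Fin n → ℕ} {Ms : Fin n → Tm S}
    {i : Fin n} {N : Tm S} (h : Rewrites R (Ms i) N) :
    Rewrites R (.record n ls Ms) (.record n ls (Function.update Ms i N)) := by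
  have := Relation.ReflTransGen.lift (fun N => Tm.record n ls (Function.update Ms i N))
    (p := Compat R)
    (fun a b hab => by
      have := Compat.record (ls := ls) (Ms := Function.update Ms i a) i (by simpa using hab)
      simpa using this) _ _ h
  simpa [Function.onFun] using this

theorem forall_update {n : ℕ} {T : Fin n → Type} {P : ∀ i, T i → T i → Prop} {f g : ∀ i, T i}
    (h : ∀ i, P i (f i) (g i)) {i : Fin n} {a b : T i} (hab : P i a b) (j : Fin n) :
    P j (Function.update f i a j) (Function.update g i b j) := by
  rcases eq_or_ne j i with rfl | hj
  · simpa using hab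
  · simpa [hj] using h j

/-- The number of answering steps varies: none for a step inside a forgotten body, two (projection,
then β) when an `any`-function is applied to its argument. -/
theorem RelQ.simulates {Γ : List (Ty S.Base)} {M M' N : Tm S} {A : Ty S.Base}
    (h : RelQ Γ M A M') (hs : Compat Stage1 M N) :
    ∃ N', Rewrites Stage1 M' N' ∧ RelQ Γ N A N' := by
  induction h generalizing N with
  | var h => cases hs with | here hs => cases hs
  | const h => cases hs with | here hs => cases hs
  | op h ho ih =>
    cases hs with
    | here hs => cases hs
    | op i hs =>
      obtain ⟨N', h₁, h₂⟩ := ih i hs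
      exact ⟨_, Rewrites.op h₁, .op (forall_update (P := fun i M M' => RelQ _ M _ M') h h₂) ho⟩
  | lamPl =>
    cases hs with
    | here hs => cases hs
    | lam hs => exact ⟨_, .refl, .lamPl⟩
  | lamDb h ih =>
    cases hs with
    | here hs => cases hs
    | lam hs =>
      obtain ⟨N', h₁, h₂⟩ := ih hs
      exact ⟨_, h₁.lift _ fun _ _ => Compat.lam, .lamDb h₂⟩
  | @lamAny _ _ _ _ A' _ _ h hP ih =>
    cases hs with
    | here hs => cases hs
    | lam hs =>
      obtain ⟨N', h₁, h₂⟩ := ih hs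
      refine ⟨_, Rewrites.record (i := 1) ?_, .lamAny (A' := A') h₂ (Function.update_self ..)⟩
      rw [hP]
      exact h₁.lift _ fun _ _ => Compat.lam
  | appDb h₁ h₂ ih₁ ih₂ =>
    cases hs with
    | here hs =>
      cases hs with
      | beta =>
        cases h₁ with
        | lamDb h₁ => exact ⟨_, .single (.here .beta), h₁.inst h₂⟩
    | appL hs =>
      obtain ⟨N', h₃, h₄⟩ := ih₁ hs
      exact ⟨_, h₃.lift _ fun _ _ => Compat.appL, .appDb h₄ h₂⟩
    | appR hs =>
      obtain ⟨N', h₃, h₄⟩ := ih₂ hs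
      exact ⟨_, h₃.lift _ fun _ _ => Compat.appR, .appDb h₁ h₄⟩
  | appAny h₁ h₂ ih₁ ih₂ =>
    cases hs with
    | here hs =>
      cases hs with
      | beta =>
        cases h₁ with
        | lamAny h₁ hP =>
          refine ⟨_, .head (.appL (.here (.proj 1 rfl))) ?_, h₁.inst h₂⟩
          rw [hP]
          exact .single (.here .beta)
    | appL hs =>
      obtain ⟨N', h₃, h₄⟩ := ih₁ hs
      exact ⟨_, h₃.lift _ fun _ _ h => Compat.appL (Compat.proj h), .appAny h₄ h₂⟩
    | appR hs =>
      obtain ⟨N', h₃, h₄⟩ := ih₂ hs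
      exact ⟨_, h₃.lift _ fun _ _ => Compat.appR, .appAny h₁ h₄⟩
  | appLam h₁ h₂ ih₁ ih₂ =>
    cases hs with
    | here hs => cases hs with | beta => exact ⟨_, .single (.here .beta), h₁.inst h₂⟩
    | appL hs =>
      cases hs with
      | here hs => cases hs
      | lam hs =>
        obtain ⟨N', h₃, h₄⟩ := ih₁ hs
        exact ⟨_, h₃.lift _ fun _ _ h => Compat.appL (Compat.lam h), .appLam h₄ h₂⟩
    | appR hs =>
      obtain ⟨N', h₃, h₄⟩ := ih₂ hs
      exact ⟨_, h₃.lift _ fun _ _ => Compat.appR, .appLam h₁ h₄⟩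
  | ite h₁ h₂ ih₁ ih₂ =>
    cases hs with
    | here hs =>
      cases hs with
      | iteTrue => cases h₁; exact ⟨_, .single (.here .iteTrue), h₂⟩
      | iteFalse => cases h₁; exact ⟨_, .single (.here .iteFalse), .empty⟩
    | iteL hs =>
      obtain ⟨N', h₃, h₄⟩ := ih₁ hs
      exact ⟨_, h₃.lift _ fun _ _ => Compat.iteL, .ite h₄ h₂⟩
    | iteR hs =>
      obtain ⟨N', h₃, h₄⟩ := ih₂ hs
      exact ⟨_, h₃.lift _ fun _ _ => Compat.iteR, .ite h₁ h₄⟩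
  | record hl h ih =>
    cases hs with
    | here hs => cases hs
    | record i hs =>
      obtain ⟨N', h₁, h₂⟩ := ih i hs
      exact ⟨_, Rewrites.record h₁, .record hl
        (forall_update (P := fun i M M' => RelQ _ M _ M') h h₂)⟩
  | proj i h hl hA ih =>
    cases hs with
    | here hs =>
      cases hs with
      | proj j hj =>
        cases h with
        | record hi h =>
          -- The rule and the typing may choose different fields with the label; injectivity of the
          -- labels identifies them.
          obtain rfl := hi (hj.trans hl.symm)
          subst hA
          exact ⟨_, .single (.here (.proj j hl)), h j⟩
    | proj hs =>
      obtain ⟨N', h₁, h₂⟩ := ih hs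
      exact ⟨_, h₁.lift _ fun _ _ => Compat.proj, .proj i h₂ hl hA⟩
  | empty => cases hs with | here hs => cases hs
  | single h ih =>
    cases hs with
    | here hs => cases hs
    | single hs =>
      obtain ⟨N', h₁, h₂⟩ := ih hs
      exact ⟨_, h₁.lift _ fun _ _ => Compat.single, .single h₂⟩
  | union h₁ h₂ ih₁ ih₂ =>
    cases hs with
    | here hs => cases hs
    | unionL hs =>
      obtain ⟨N', h₃, h₄⟩ := ih₁ hs
      exact ⟨_, h₃.lift _ fun _ _ => Compat.unionL, .union h₄ h₂⟩
    | unionR hs =>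
      obtain ⟨N', h₃, h₄⟩ := ih₂ hs
      exact ⟨_, h₃.lift _ fun _ _ => Compat.unionR, .union h₁ h₄⟩
  | forIn h₁ h₂ ih₁ ih₂ =>
    cases hs with
    | here hs =>
      cases hs with
      | forSingle =>
        cases h₁ with
        | single h₁ => exact ⟨_, .single (.here .forSingle), h₂.inst h₁⟩
      | forFor =>
        cases h₁ with
        | forIn h₁ h₃ =>
          exact ⟨_, .single (.here .forFor),
            .forIn h₁ (.forIn h₃ (h₂.rename ((RenTyped.succ _ _).up _)))⟩
      | forIte =>
        cases h₁ with
        | ite h₁ h₃ => exact ⟨_, .single (.here .forIte), .ite h₁ (.forIn h₃ h₂)⟩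
      | forEmpty => cases h₁; exact ⟨_, .single (.here .forEmpty), .empty⟩
      | forUnion =>
        cases h₁ with
        | union h₁ h₃ =>
          exact ⟨_, .single (.here .forUnion), .union (.forIn h₁ h₂) (.forIn h₃ h₂)⟩
    | forL hs =>
      obtain ⟨N', h₃, h₄⟩ := ih₁ hs
      exact ⟨_, h₃.lift _ fun _ _ => Compat.forL, .forIn h₄ h₂⟩
    | forR hs =>
      obtain ⟨N', h₃, h₄⟩ := ih₂ hs
      exact ⟨_, h₃.lift _ fun _ _ => Compat.forR, .forIn h₁ h₄⟩
  | table => cases hs with | here hs => cases hs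
  | recFn =>
    cases hs with
    | here hs => cases hs
    | recFn hs => exact ⟨_, .refl, .recFn⟩

/-- Conversely, the source stands still when the translation projects a copy or rewrites inside a
forgotten part. -/
theorem RelQ.simulated {Γ : List (Ty S.Base)} {M M' N' : Tm S} {A : Ty S.Base}
    (h : RelQ Γ M A M') (hs : Compat Stage1 M' N') :
    ∃ N, Rewrites Stage1 M N ∧ RelQ Γ N A N' := by
  induction h generalizing N' with
  | var h => cases hs with | here hs => cases hs
  | const h => cases hs with | here hs => cases hs
  | op h ho ih =>
    cases hs with
    | here hs => cases hs
    | op i hs =>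
      obtain ⟨N, h₁, h₂⟩ := ih i hs
      exact ⟨_, Rewrites.op h₁, .op (forall_update (P := fun i M M' => RelQ _ M _ M') h h₂) ho⟩
  | lamPl =>
    cases hs with
    | here hs => cases hs
    | lam hs => exact ⟨_, .refl, .lamPl⟩
  | lamDb h ih =>
    cases hs with
    | here hs => cases hs
    | lam hs =>
      obtain ⟨N, h₁, h₂⟩ := ih hs
      exact ⟨_, h₁.lift _ fun _ _ => Compat.lam, .lamDb h₂⟩
  | lamAny h hP ih =>
    cases hs with
    | here hs => cases hs
    | record i hs =>
      match i with
      -- Rewriting in the `pl`-copy leaves the relation intact, because only component `1` is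
      -- constrained.
      | 0 => exact ⟨_, .refl, .lamAny h (by simpa using hP)⟩
      | 1 =>
        rw [hP] at hs
        cases hs with
        | here hs => cases hs
        | lam hs =>
          obtain ⟨N, h₁, h₂⟩ := ih hs
          exact ⟨_, h₁.lift _ fun _ _ => Compat.lam, .lamAny h₂ (Function.update_self ..)⟩
  | appDb h₁ h₂ ih₁ ih₂ =>
    cases hs with
    | here hs =>
      cases hs with
      | beta =>
        cases h₁ with
        | lamDb h₁ => exact ⟨_, .single (.here .beta), h₁.inst h₂⟩
    | appL hs =>
      obtain ⟨N, h₃, h₄⟩ := ih₁ hs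
      exact ⟨_, h₃.lift _ fun _ _ => Compat.appL, .appDb h₄ h₂⟩
    | appR hs =>
      obtain ⟨N, h₃, h₄⟩ := ih₂ hs
      exact ⟨_, h₃.lift _ fun _ _ => Compat.appR, .appDb h₁ h₄⟩
  | appAny h₁ h₂ ih₁ ih₂ =>
    cases hs with
    | here hs => cases hs
    | appL hs =>
      cases hs with
      | here hs =>
        cases hs with
        | proj i hi =>
          cases h₁ with
          | lamAny h₁ hP =>
            match i with
            | 1 =>
              rw [hP]
              exact ⟨_, .refl, .appLam h₁ h₂⟩
      | proj hs =>
        obtain ⟨N, h₃, h₄⟩ := ih₁ hs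
        exact ⟨_, h₃.lift _ fun _ _ => Compat.appL, .appAny h₄ h₂⟩
    | appR hs =>
      obtain ⟨N, h₃, h₄⟩ := ih₂ hs
      exact ⟨_, h₃.lift _ fun _ _ => Compat.appR, .appAny h₁ h₄⟩
  | appLam h₁ h₂ ih₁ ih₂ =>
    cases hs with
    | here hs => cases hs with | beta => exact ⟨_, .single (.here .beta), h₁.inst h₂⟩
    | appL hs =>
      cases hs with
      | here hs => cases hs
      | lam hs =>
        obtain ⟨N, h₃, h₄⟩ := ih₁ hs
        exact ⟨_, h₃.lift _ fun _ _ h => Compat.appL (Compat.lam h), .appLam h₄ h₂⟩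
    | appR hs =>
      obtain ⟨N, h₃, h₄⟩ := ih₂ hs
      exact ⟨_, h₃.lift _ fun _ _ => Compat.appR, .appLam h₁ h₄⟩
  | ite h₁ h₂ ih₁ ih₂ =>
    cases hs with
    | here hs =>
      cases hs with
      | iteTrue => cases h₁; exact ⟨_, .single (.here .iteTrue), h₂⟩
      | iteFalse => cases h₁; exact ⟨_, .single (.here .iteFalse), .empty⟩
    | iteL hs =>
      obtain ⟨N, h₃, h₄⟩ := ih₁ hs
      exact ⟨_, h₃.lift _ fun _ _ => Compat.iteL, .ite h₄ h₂⟩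
    | iteR hs =>
      obtain ⟨N, h₃, h₄⟩ := ih₂ hs
      exact ⟨_, h₃.lift _ fun _ _ => Compat.iteR, .ite h₁ h₄⟩
  | record hl h ih =>
    cases hs with
    | here hs => cases hs
    | record i hs =>
      obtain ⟨N, h₁, h₂⟩ := ih i hs
      exact ⟨_, Rewrites.record h₁, .record hl
        (forall_update (P := fun i M M' => RelQ _ M _ M') h h₂)⟩
  | proj i h hl hA ih =>
    cases hs with
    | here hs =>
      cases hs with
      | proj j hj =>
        cases h with
        | record hi h =>
          obtain rfl := hi (hj.trans hl.symm)
          subst hA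
          exact ⟨_, .single (.here (.proj j hl)), h j⟩
    | proj hs =>
      obtain ⟨N, h₁, h₂⟩ := ih hs
      exact ⟨_, h₁.lift _ fun _ _ => Compat.proj, .proj i h₂ hl hA⟩
  | empty => cases hs with | here hs => cases hs
  | single h ih =>
    cases hs with
    | here hs => cases hs
    | single hs =>
      obtain ⟨N, h₁, h₂⟩ := ih hs
      exact ⟨_, h₁.lift _ fun _ _ => Compat.single, .single h₂⟩
  | union h₁ h₂ ih₁ ih₂ =>
    cases hs with
    | here hs => cases hs
    | unionL hs =>
      obtain ⟨N, h₃, h₄⟩ := ih₁ hs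
      exact ⟨_, h₃.lift _ fun _ _ => Compat.unionL, .union h₄ h₂⟩
    | unionR hs =>
      obtain ⟨N, h₃, h₄⟩ := ih₂ hs
      exact ⟨_, h₃.lift _ fun _ _ => Compat.unionR, .union h₁ h₄⟩
  | forIn h₁ h₂ ih₁ ih₂ =>
    cases hs with
    | here hs =>
      cases hs with
      | forSingle =>
        cases h₁ with
        | single h₁ => exact ⟨_, .single (.here .forSingle), h₂.inst h₁⟩
      | forFor =>
        cases h₁ with
        | forIn h₁ h₃ =>
          exact ⟨_, .single (.here .forFor),
            .forIn h₁ (.forIn h₃ (h₂.rename ((RenTyped.succ _ _).up _)))⟩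
      | forIte =>
        cases h₁ with
        | ite h₁ h₃ => exact ⟨_, .single (.here .forIte), .ite h₁ (.forIn h₃ h₂)⟩
      | forEmpty => cases h₁; exact ⟨_, .single (.here .forEmpty), .empty⟩
      | forUnion =>
        cases h₁ with
        | union h₁ h₃ =>
          exact ⟨_, .single (.here .forUnion), .union (.forIn h₁ h₂) (.forIn h₃ h₂)⟩
    | forL hs =>
      obtain ⟨N, h₃, h₄⟩ := ih₁ hs
      exact ⟨_, h₃.lift _ fun _ _ => Compat.forL, .forIn h₄ h₂⟩
    | forR hs =>
      obtain ⟨N, h₃, h₄⟩ := ih₂ hs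
      exact ⟨_, h₃.lift _ fun _ _ => Compat.forR, .forIn h₁ h₄⟩
  | table => cases hs with | here hs => cases hs
  | recFn =>
    cases hs with
    | here hs => cases hs
    | recFn hs => exact ⟨_, .refl, .recFn⟩

theorem RelQ.simulates_star {Γ : List (Ty S.Base)} {M M' N : Tm S} {A : Ty S.Base}
    (h : RelQ Γ M A M') (hs : Rewrites Stage1 M N) :
    ∃ N', Rewrites Stage1 M' N' ∧ RelQ Γ N A N' := by
  induction hs with
  | refl => exact ⟨_, .refl, h⟩
  | tail _ hs ih =>
    obtain ⟨K, h₁, h₂⟩ := ih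
    obtain ⟨K', h₃, h₄⟩ := h₂.simulates hs
    exact ⟨K', h₁.trans h₃, h₄⟩

theorem RelQ.simulated_star {Γ : List (Ty S.Base)} {M M' N' : Tm S} {A : Ty S.Base}
    (h : RelQ Γ M A M') (hs : Rewrites Stage1 M' N') :
    ∃ N, Rewrites Stage1 M N ∧ RelQ Γ N A N' := by
  induction hs with
  | refl => exact ⟨_, .refl, h⟩
  | tail _ hs ih =>
    obtain ⟨K, h₁, h₂⟩ := ih
    obtain ⟨K', h₃, h₄⟩ := h₂.simulated hs
    exact ⟨K', h₁.trans h₃, h₄⟩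

/-! ### Normal forms of flat type -/

/-- Types without function types. -/
def Ty.ArrowFree {B : Type} : Ty B → Prop
  | .base _ => True
  | .record _ _ As => ∀ i, (As i).ArrowFree
  | .bag A => A.ArrowFree
  | .arrow _ _ _ => False

theorem Ty.ArrowFree.dup_eq {B : Type} {A : Ty B} (h : A.ArrowFree) : A.dup = A := by
  induction A with
  | base => rfl
  | record n ls As ih => simp only [Ty.dup, ih _ (h _)]
  | bag A ih => simp only [Ty.dup, ih h]
  | arrow => exact h.elim

theorem Row.arrowFree {B : Type} (R : Row B) : R.toTy.ArrowFree := fun _ => trivial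

/-- Typing at effect `db` of terms without functions, queries and folds. -/
inductive Flat : List (Ty S.Base) → Tm S → Ty S.Base → Prop
  | var {Γ : List (Ty S.Base)} {x : ℕ} {A : Ty S.Base} :
      Γ[x]? = some A → Flat Γ (.var x) A
  | const {Γ : List (Ty S.Base)} {c : S.Const} {O : S.Base} :
      S.constTy c = O → Flat Γ (.const c) (.base O)
  | op {Γ : List (Ty S.Base)} {o : S.Op} {Ms : Fin (S.arity o) → Tm S} {O : S.Base} :
      (∀ i, Flat Γ (Ms i) (.base (S.opDom o i))) → S.opCod o = O → Flat Γ (.op o Ms) (.base O)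
  | ite {Γ : List (Ty S.Base)} {L M : Tm S} {A : Ty S.Base} :
      Flat Γ L (.base S.bool) → Flat Γ M (.bag A) → Flat Γ (.ite L M) (.bag A)
  | record {Γ : List (Ty S.Base)} {n : ℕ} {ls : Fin n → ℕ} {Ms : Fin n → Tm S}
      {As : Fin n → Ty S.Base} :
      Function.Injective ls → (∀ i, Flat Γ (Ms i) (As i)) →
      Flat Γ (.record n ls Ms) (.record n ls As)
  | proj {Γ : List (Ty S.Base)} {n : ℕ} {ls : Fin n → ℕ} {M : Tm S}
      {As : Fin n → Ty S.Base} {l : ℕ} {A : Ty S.Base} (i : Fin n) :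
      Flat Γ M (.record n ls As) → ls i = l → As i = A → Flat Γ (.proj M l) A
  | empty {Γ : List (Ty S.Base)} {A : Ty S.Base} : Flat Γ .empty (.bag A)
  | single {Γ : List (Ty S.Base)} {M : Tm S} {A : Ty S.Base} :
      Flat Γ M A → Flat Γ (.single M) (.bag A)
  | union {Γ : List (Ty S.Base)} {M N : Tm S} {A : Ty S.Base} :
      Flat Γ M (.bag A) → Flat Γ N (.bag A) → Flat Γ (.union M N) (.bag A)
  | forIn {Γ : List (Ty S.Base)} {M N : Tm S} {A B : Ty S.Base} :
      Flat Γ M (.bag A) → Flat (A :: Γ) N (.bag B) → Flat Γ (.for A M N) (.bag B)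
  | table {Γ : List (Ty S.Base)} {t : S.Table} :
      Flat Γ (.table t) (.bag (S.tableRow t).toTy)

theorem Flat.typed {Γ : List (Ty S.Base)} {M : Tm S} {A : Ty S.Base} (h : Flat Γ M A) :
    Nonempty (Typed Γ M A .db) := by
  induction h with
  | var h => exact ⟨.var h⟩
  | const h => exact ⟨.const h⟩
  | op _ h ih => exact ⟨.op (fun i => (ih i).some) h⟩
  | ite _ _ ih₁ ih₂ => exact ⟨.ite ih₁.some ih₂.some⟩
  | record h _ ih => exact ⟨.record h fun i => (ih i).some⟩
  | proj i _ h₁ h₂ ih => exact ⟨.proj i ih.some h₁ h₂⟩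
  | empty => exact ⟨.empty⟩
  | single _ ih => exact ⟨.single ih.some⟩
  | union _ _ ih₁ ih₂ => exact ⟨.union ih₁.some ih₂.some⟩
  | forIn _ _ ih₁ ih₂ => exact ⟨.for ih₁.some ih₂.some⟩
  | table => exact ⟨.table⟩

theorem Flat.rename {Γ Δ : List (Ty S.Base)} {M : Tm S} {A : Ty S.Base} {ξ : ℕ → ℕ}
    (h : Flat Γ M A) (hξ : RenTyped Γ Δ ξ) : Flat Δ (M.rename ξ) A := by
  induction h generalizing Δ ξ with
  | var h => exact .var (hξ _ _ h)
  | const h => exact .const h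
  | op _ h ih => exact .op (fun i => ih i hξ) h
  | ite _ _ ih₁ ih₂ => exact .ite (ih₁ hξ) (ih₂ hξ)
  | record h _ ih => exact .record h fun i => ih i hξ
  | proj i _ h₁ h₂ ih => exact .proj i (ih hξ) h₁ h₂
  | empty => exact .empty
  | single _ ih => exact .single (ih hξ)
  | union _ _ ih₁ ih₂ => exact .union (ih₁ hξ) (ih₂ hξ)
  | forIn _ _ ih₁ ih₂ => exact .forIn (ih₁ hξ) (ih₂ (hξ.up _))
  | table => exact .table

theorem Flat.and {Γ : List (Ty S.Base)} {L M : Tm S} (hL : Flat Γ L (.base S.bool))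
    (hM : Flat Γ M (.base S.bool)) : Flat Γ (Tm.and L M) (.base S.bool) := by
  refine .op (fun i => ?_) S.opCod_conj
  rw [S.opDom_conj]
  split_ifs
  exacts [hL, hM]

/-- Stage 2 performs no substitution; the only change of context is the weakening of a condition
moved under a loop. -/
theorem Flat.stage2 {Γ : List (Ty S.Base)} {M N : Tm S} {A : Ty S.Base} (h : Flat Γ M A)
    (hs : Compat Stage2 M N) : Flat Γ N A := by
  induction h generalizing N with
  | var h => cases hs with | here hs => cases hs
  | const h => cases hs with | here hs => cases hs
  | op h ho ih =>
    cases hs with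
    | here hs => cases hs
    -- The lemma on binary relations is applied to a predicate, so the second family is a dummy.
    | op i hs => exact .op (forall_update (P := fun i M _ => Flat _ M _) (g := fun _ => Tm.empty)
      (b := Tm.empty) h (ih i hs)) ho
  | ite h₁ h₂ ih₁ ih₂ =>
    cases hs with
    | here hs =>
      cases hs with
      | iteUnion => cases h₂ with | union h₂ h₃ => exact .union (.ite h₁ h₂) (.ite h₁ h₃)
      | iteEmpty => exact .empty
      | iteIte => cases h₂ with | ite h₂ h₃ => exact .ite (h₁.and h₂) h₃
      | iteFor =>
        cases h₂ with | forIn h₂ h₃ => exact .forIn h₂ (.ite (h₁.rename (.succ _ _)) h₃)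
    | iteL hs => exact .ite (ih₁ hs) h₂
    | iteR hs => exact .ite h₁ (ih₂ hs)
  | record hl h ih =>
    cases hs with
    | here hs => cases hs
    | record i hs => exact .record hl (forall_update (P := fun i M _ => Flat _ M _) (g := fun _ => Tm.empty)
      (b := Tm.empty) h (ih i hs))
  | proj i h hl hA ih =>
    cases hs with
    | here hs => cases hs
    | proj hs => exact .proj i (ih hs) hl hA
  | empty => cases hs with | here hs => cases hs
  | single h ih =>
    cases hs with
    | here hs => cases hs
    | single hs => exact .single (ih hs)
  | union h₁ h₂ ih₁ ih₂ =>
    cases hs with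
    | here hs => cases hs
    | unionL hs => exact .union (ih₁ hs) h₂
    | unionR hs => exact .union h₁ (ih₂ hs)
  | forIn h₁ h₂ ih₁ ih₂ =>
    cases hs with
    | here hs =>
      cases hs with
      | forUnion => cases h₂ with | union h₂ h₃ => exact .union (.forIn h₁ h₂) (.forIn h₁ h₃)
      | forEmpty => exact .empty
    | forL hs => exact .forIn (ih₁ hs) h₂
    | forR hs => exact .forIn h₁ (ih₂ hs)
  | table => cases hs with | here hs => cases hs

theorem Flat.stage2_star {Γ : List (Ty S.Base)} {M N : Tm S} {A : Ty S.Base} (h : Flat Γ M A)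
    (hs : Rewrites Stage2 M N) : Flat Γ N A := by
  induction hs with
  | refl => exact h
  | tail _ hs ih => exact ih.stage2 hs

/-- Terms that are formed by an introduction rule or consist of a conditional or a loop. -/
inductive IsIntro : Tm S → Prop
  | lam {E : Eff} {A : Ty S.Base} {M : Tm S} : IsIntro (.lam E A M)
  | recFn {A B : Ty S.Base} {M : Tm S} : IsIntro (.recFn A B M)
  | record {n : ℕ} {ls : Fin n → ℕ} {Ms : Fin n → Tm S} : IsIntro (.record n ls Ms)
  | ite {L M : Tm S} : IsIntro (.ite L M)
  | empty : IsIntro .empty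
  | single {M : Tm S} : IsIntro (.single M)
  | union {M N : Tm S} : IsIntro (.union M N)
  | forIn {A : Ty S.Base} {M N : Tm S} : IsIntro (.for A M N)

/-- No rewriting step is possible. -/
def Irreducible (R : Tm S → Tm S → Prop) (M : Tm S) : Prop :=
  ∀ N, ¬ Compat R M N

theorem Irreducible.of_ctx {R : Tm S → Tm S → Prop} {M : Tm S} {C : Tm S → Tm S} {K : Tm S}
    (hC : ∀ N, Compat R M N → Compat R K (C N)) (h : Irreducible R K) : Irreducible R M :=
  fun _ hN => h _ (hC _ hN)

/-- A subformula property. A term whose type contains a function type is an introduction form, a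
conditional or a loop; eliminating it by application, projection or iteration would give a redex on
both sides, by β, projection or a rule for `for`. Hence in a normal term of function-free type every
relevant subterm has function-free type too, and there the two sides agree. The two claims support
each other in the induction, and normality of either side is enough. -/
theorem RelQ.normal {Γ : List (Ty S.Base)} {M M' : Tm S} {A : Ty S.Base} (h : RelQ Γ M A M')
    (hΓ : ∀ B ∈ Γ, B.ArrowFree) (hn : Irreducible Stage1 M ∨ Irreducible Stage1 M') :
    (A.ArrowFree → Flat Γ M A ∧ M' = M) ∧ (¬ A.ArrowFree → IsIntro M) := by
  induction h with
  | var h => exact ⟨fun _ => ⟨.var h, rfl⟩, fun hA => (hA (hΓ _ (List.mem_of_getElem? h))).elim⟩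
  | const h => exact ⟨fun _ => ⟨.const h, rfl⟩, fun hA => (hA trivial).elim⟩
  | op h ho ih =>
    have ih := fun i => (ih i hΓ (hn.imp (.of_ctx fun _ => .op i) (.of_ctx fun _ => .op i))).1
      trivial
    refine ⟨fun _ => ⟨.op (fun i => (ih i).1) ho, ?_⟩, fun hA => (hA trivial).elim⟩
    congr 1
    exact funext fun i => (ih i).2
  | lamPl => exact ⟨False.elim, fun _ => .lam⟩
  | lamDb h ih => exact ⟨False.elim, fun _ => .lam⟩
  | lamAny h hP ih => exact ⟨False.elim, fun _ => .lam⟩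
  | appDb h₁ h₂ ih₁ ih₂ =>
    exfalso
    have hi := (ih₁ hΓ (hn.imp (.of_ctx fun _ => .appL) (.of_ctx fun _ => .appL))).2 id
    -- Among introduction forms only a `db`-abstraction has this type, and applying it is a redex on
    -- both sides.
    cases h₁ <;> cases hi
    exact hn.elim (fun hn => hn _ (.here .beta)) (fun hn => hn _ (.here .beta))
  | appAny h₁ h₂ ih₁ ih₂ =>
    exfalso
    have hi := (ih₁ hΓ (hn.imp (.of_ctx fun _ => .appL)
      (.of_ctx fun _ h => .appL (.proj h)))).2 id
    cases h₁ <;> cases hi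
    exact hn.elim (fun hn => hn _ (.here .beta)) (fun hn => hn _ (.appL (.here (.proj 1 rfl))))
  | appLam h₁ h₂ ih₁ ih₂ =>
    exact (hn.elim (fun hn => hn _ (.here .beta)) (fun hn => hn _ (.here .beta))).elim
  | ite h₁ h₂ ih₁ ih₂ =>
    have ih₁ := (ih₁ hΓ (hn.imp (.of_ctx fun _ => .iteL) (.of_ctx fun _ => .iteL))).1 trivial
    have ih₂ := (ih₂ hΓ (hn.imp (.of_ctx fun _ => .iteR) (.of_ctx fun _ => .iteR))).1
    exact ⟨fun hA => ⟨.ite ih₁.1 (ih₂ hA).1, by rw [ih₁.2, (ih₂ hA).2]⟩, fun _ => .ite⟩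
  | record hl h ih =>
    have ih := fun i => (ih i hΓ (hn.imp (.of_ctx fun _ => .record i)
      (.of_ctx fun _ => .record i))).1
    refine ⟨fun hA => ⟨.record hl (fun i => (ih i (hA i)).1), ?_⟩, fun _ => .record⟩
    congr 1
    exact funext fun i => (ih i (hA i)).2
  | @proj _ n ls _ _ As _ _ i h hl hA ih =>
    have ih := ih hΓ (hn.imp (.of_ctx fun _ => .proj) (.of_ctx fun _ => .proj))
    by_cases hR : (Ty.record n ls As).ArrowFree
    · refine ⟨fun _ => ⟨.proj i (ih.1 hR).1 hl hA, by rw [(ih.1 hR).2]⟩, fun h => ?_⟩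
      subst hA
      exact (h (hR i)).elim
    · exfalso
      have hi := ih.2 hR
      cases h <;> cases hi
      exact hn.elim (fun hn => hn _ (.here (.proj i hl))) (fun hn => hn _ (.here (.proj i hl)))
  | empty => exact ⟨fun _ => ⟨.empty, rfl⟩, fun _ => .empty⟩
  | single h ih =>
    have ih := (ih hΓ (hn.imp (.of_ctx fun _ => .single) (.of_ctx fun _ => .single))).1
    exact ⟨fun hA => ⟨.single (ih hA).1, by rw [(ih hA).2]⟩, fun _ => .single⟩
  | union h₁ h₂ ih₁ ih₂ =>
    have ih₁ := (ih₁ hΓ (hn.imp (.of_ctx fun _ => .unionL) (.of_ctx fun _ => .unionL))).1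
    have ih₂ := (ih₂ hΓ (hn.imp (.of_ctx fun _ => .unionR) (.of_ctx fun _ => .unionR))).1
    exact ⟨fun hA => ⟨.union (ih₁ hA).1 (ih₂ hA).1, by rw [(ih₁ hA).2, (ih₂ hA).2]⟩,
      fun _ => .union⟩
  | @forIn _ _ _ _ _ A _ h₁ h₂ ih₁ ih₂ =>
    have ih₁ := ih₁ hΓ (hn.imp (.of_ctx fun _ => .forL) (.of_ctx fun _ => .forL))
    by_cases hA : A.ArrowFree
    · have ih₁ := ih₁.1 hA
      have ih₂ := (ih₂ (List.forall_mem_cons.mpr ⟨hA, hΓ⟩)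
        (hn.imp (.of_ctx fun _ => .forR) (.of_ctx fun _ => .forR))).1
      -- The annotations agree because doubling fixes function-free types.
      exact ⟨fun hB => ⟨.forIn ih₁.1 (ih₂ hB).1, by rw [ih₁.2, (ih₂ hB).2, hA.dup_eq]⟩,
        fun _ => .forIn⟩
    · exfalso
      have hi := ih₁.2 hA
      cases h₁ <;> cases hi
      · exact hn.elim (fun hn => hn _ (.here .forIte)) (fun hn => hn _ (.here .forIte))
      · exact hn.elim (fun hn => hn _ (.here .forEmpty)) (fun hn => hn _ (.here .forEmpty))
      · exact hn.elim (fun hn => hn _ (.here .forSingle)) (fun hn => hn _ (.here .forSingle))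
      · exact hn.elim (fun hn => hn _ (.here .forUnion)) (fun hn => hn _ (.here .forUnion))
      · exact hn.elim (fun hn => hn _ (.here .forFor)) (fun hn => hn _ (.here .forFor))
  | @table _ t => exact ⟨fun _ => ⟨.table, rfl⟩, fun h => (h (S.tableRow t).arrowFree).elim⟩
  | recFn => exact ⟨False.elim, fun _ => .recFn⟩

/-- The translation follows the source to some term related to the normal form `K`, and that term
can only be `K` itself. -/
theorem RelQ.normalFormOf {M M' K : Tm S} {A : Ty S.Base} (h : RelQ [] M A M')
    (hA : A.ArrowFree) (hK : NormalFormOf Stage1 M K) :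
    NormalFormOf Stage1 M' K ∧ Flat [] K A := by
  obtain ⟨K', h₁, h₂⟩ := h.simulates_star hK.1
  obtain ⟨h₃, rfl⟩ := (h₂.normal (by simp) (.inl hK.2)).1 hA
  exact ⟨⟨h₁, hK.2⟩, h₃⟩

theorem RelQ.normalFormOf' {M M' K : Tm S} {A : Ty S.Base} (h : RelQ [] M A M')
    (hA : A.ArrowFree) (hK : NormalFormOf Stage1 M' K) : NormalFormOf Stage1 M K := by
  obtain ⟨K', h₁, h₂⟩ := h.simulated_star hK.1
  obtain ⟨-, rfl⟩ := (h₂.normal (by simp) (.inr hK.2)).1 hA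
  exact ⟨h₁, hK.2⟩

theorem RelQ.normalises_iff {M M' q : Tm S} {A : Ty S.Base} (h : RelQ [] M A M')
    (hA : A.ArrowFree) : Normalises M q ↔ Normalises M' q :=
  ⟨fun ⟨K, h₁, h₂⟩ => ⟨K, (h.normalFormOf hA h₁).1, h₂⟩,
    fun ⟨K, h₁, h₂⟩ => ⟨K, h.normalFormOf' hA h₁, h₂⟩⟩

theorem RelQ.typed_of_normalises {M M' q : Tm S} {A : Ty S.Base} (h : RelQ [] M A M')
    (hA : A.ArrowFree) (hq : Normalises M q) : Nonempty (Typed [] q A .db) := by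
  obtain ⟨K, h₁, h₂⟩ := hq
  exact ((h.normalFormOf hA h₁).2.stage2_star h₂.1).typed

/-! ## Values and responses -/

theorem RelP.exists_coll {Γ : List (Ty S.Base)} {Vs : List (Tm S)} {M' : Tm S} {A : Ty S.Base}
    (h : RelP Γ (Tm.coll Vs) A M')
    (hV : ∀ V ∈ Vs, ∀ B V', RelP Γ V B V' → Value V') :
    ∃ Vs', M' = Tm.coll Vs' ∧ ∀ V' ∈ Vs', Value V' := by
  induction Vs generalizing M' A with
  | nil =>
    cases h
    exact ⟨[], rfl, by simp⟩
  | cons V Vs ih =>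
    rw [List.forall_mem_cons] at hV
    cases h with
    | union h₁ h₂ =>
      cases h₁ with
      | single h₁ =>
        obtain ⟨Vs', rfl, hv⟩ := ih h₂ hV.2
        exact ⟨_ :: Vs', rfl, List.forall_mem_cons.mpr ⟨hV.1 _ _ h₁, hv⟩⟩

theorem RelP.exists_coll' {Γ : List (Ty S.Base)} {Vs : List (Tm S)} {M : Tm S} {A : Ty S.Base}
    (h : RelP Γ M A (Tm.coll Vs)) (hV : ∀ V' ∈ Vs, ∀ B V, RelP Γ V B V' → Value V) :
    ∃ Vs', M = Tm.coll Vs' ∧ ∀ V ∈ Vs', Value V := by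
  induction Vs generalizing M A with
  | nil =>
    cases h
    exact ⟨[], rfl, by simp⟩
  | cons V Vs ih =>
    rw [List.forall_mem_cons] at hV
    cases h with
    | union h₁ h₂ =>
      cases h₁ with
      | single h₁ =>
        obtain ⟨Vs', rfl, hv⟩ := ih h₂ hV.2
        exact ⟨_ :: Vs', rfl, List.forall_mem_cons.mpr ⟨hV.1 _ _ h₁, hv⟩⟩

/-- The doubling of an abstraction is an abstraction or a pair of abstractions, hence a value.
Together with the converse below, this transfers the side conditions of the transitions. -/
theorem Value.of_relP {Γ : List (Ty S.Base)} {M M' : Tm S} {A : Ty S.Base} (hv : Value M)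
    (h : RelP Γ M A M') : Value M' := by
  induction hv generalizing A M' with
  | const => cases h; exact .const _
  | lam =>
    cases h with
    | lamPl => exact .lam _ _ _
    | lamDb => exact .lam _ _ _
    | lamAny _ _ h₀ h₁ =>
      refine .record fun i => ?_
      match i with
      | 0 => exact h₀ ▸ .lam _ _ _
      | 1 => exact h₁ ▸ .lam _ _ _
  | recFn => cases h; exact .recFn _ _ _
  | record _ ih => cases h with | record _ h => exact .record fun i => ih i (h i)
  | coll hM _ ih =>
    subst hM
    obtain ⟨Vs', rfl, hv⟩ := h.exists_coll fun V hV B V' hV' => ih V hV hV'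
    exact .coll rfl hv

theorem Value.of_relP' {Γ : List (Ty S.Base)} {M M' : Tm S} {A : Ty S.Base} (hv : Value M')
    (h : RelP Γ M A M') : Value M := by
  induction hv generalizing A M with
  | const => cases h; exact .const _
  | lam => cases h <;> exact .lam _ _ _
  | recFn => cases h; exact .recFn _ _ _
  | record _ ih =>
    cases h with
    | record _ h => exact .record fun i => ih i (h i)
    | lamAny => exact .lam _ _ _
  | coll hM _ ih =>
    subst hM
    obtain ⟨Vs', rfl, hv⟩ := h.exists_coll' fun V hV B V' hV' => ih V hV hV'
    exact .coll rfl hv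

/-- Values have no effect of their own: abstractions already contain the `db`-information about
their bodies where it matters, and `RelQ` forgets the bodies of `pl`-functions. This is what allows
arguments computed at `pl` to be substituted into queries. -/
theorem RelP.relQ {Γ : List (Ty S.Base)} {V V' : Tm S} {A : Ty S.Base} (h : RelP Γ V A V')
    (hv : Value V) : RelQ Γ V A V' := by
  induction hv generalizing A V' with
  | const => cases h with | const h => exact .const h
  | lam =>
    cases h with
    | lamPl => exact .lamPl
    | lamDb h => exact .lamDb h
    | lamAny _ h _ hP => exact .lamAny h hP
  | recFn => cases h; exact .recFn
  | record _ ih => cases h with | record hl h => exact .record hl fun i => ih i (h i)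
  | @coll M Vs hM _ ih =>
    subst hM
    induction Vs generalizing A V' with
    | nil => cases h; exact .empty
    | cons V Vs ihl =>
      rw [List.forall_mem_cons] at ih
      cases h with
      | union h₁ h₂ =>
        cases h₁ with
        | single h₁ =>
          exact .union (.single (ih.1 h₁)) (ihl (fun V hV => ‹∀ V ∈ _, Value V› V (by simp [hV]))
            ih.2 h₂)

theorem RelP.any_value {Γ : List (Ty S.Base)} {V V' : Tm S} {A B : Ty S.Base}
    (h : RelP Γ V (.arrow A .any B) V') (hv : Value V) :
    ∃ M M₁ M₂ A₁ A₂, ∃ Ps : Fin 2 → Tm S, V = .lam .any A M ∧ V' = .record 2 ![1, 2] Ps ∧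
      RelP (A :: Γ) M B M₁ ∧ RelQ (A :: Γ) M B M₂ ∧ Ps 0 = .lam .pl A₁ M₁ ∧
      Ps 1 = .lam .db A₂ M₂ := by
  cases hv with
  | const => cases h
  | lam => cases h with | lamAny h₁ h₂ h₃ h₄ => exact ⟨_, _, _, _, _, _, rfl, rfl, h₁, h₂, h₃, h₄⟩
  | recFn => cases h
  | record => cases h
  | @coll _ Vs hM =>
    subst hM
    cases Vs <;> cases h

/-- Without function types, a value is built from constants, records and collections only, and there
is nothing to double. -/
theorem Value.relP_self {V : Tm S} {A : Ty S.Base} (hv : Value V) (d : Typed [] V A .pl)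
    (hA : A.ArrowFree) : RelP [] V A V := by
  induction hv generalizing A with
  | const => cases d with | const h => exact .const h
  | lam => cases d; exact hA.elim
  | recFn => cases d; exact hA.elim
  | record _ ih => cases d with | record hl d => exact .record hl fun i => ih i (d i) (hA i)
  | @coll M Vs hM hVs ih =>
    subst hM
    clear hVs
    induction Vs generalizing A with
    | nil => cases d; exact .empty
    | cons V Vs ihl =>
      rw [List.forall_mem_cons] at ih
      cases d with
      | union d₁ d₂ =>
        cases d₁ with
        | single d₁ => exact .union (.single (ih.1 d₁ hA)) (ihl ih.2 hA d₂)

/-! ## Simulations between related programs -/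

section Steps

variable {δ : OpInterp S} {Ω : Set (Label S)}

/-- `M'` can answer the transition of `M` to `N` with the label `μ` after some silent transitions
through terms that are related to `M`. -/
inductive Answers (δ : OpInterp S) (Ω : Set (Label S)) (M : Tm S) (A : Ty S.Base)
    (μ : Option (Label S)) (N : Tm S) : Tm S → Prop
  | step {M' N' : Tm S} : RelP [] M A M' → Step δ Ω M' μ N' → RelP [] N A N' →
      Answers δ Ω M A μ N M'
  | silent {M' K : Tm S} : RelP [] M A M' → Step δ Ω M' none K → Answers δ Ω M A μ N K →
      Answers δ Ω M A μ N M'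

theorem Answers.hatWeak {M M' N : Tm S} {A : Ty S.Base} {μ : Option (Label S)}
    (h : Answers δ Ω M A μ N M') :
    ∃ N', HatWeak (Step δ Ω) M' μ N' ∧ RelP [] N A N' := by
  induction h with
  | step _ hs h =>
    refine ⟨_, ?_, h⟩
    cases μ with
    | none => exact .single hs
    | some l => exact ⟨_, _, .refl, hs, .refl⟩
  | silent _ hs _ ih =>
    obtain ⟨N', h₁, h₂⟩ := ih
    refine ⟨N', ?_, h₂⟩
    cases μ with
    | none => exact .head hs h₁
    | some l => exact h₁.silent_left (.single hs)

/-- `hC` may use that the intermediate term is still related to `M`. The left operand of a union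
needs this: it may step only while it is not of the form `[V]`, and that property passes along the
relation. -/
theorem Answers.lift {M M' N P Q : Tm S} {A B : Ty S.Base} {μ : Option (Label S)} (C : Tm S → Tm S)
    (hP : ∀ K, RelP [] M A K → RelP [] P B (C K)) (hQ : ∀ K, RelP [] N A K → RelP [] Q B (C K))
    (hC : ∀ K K' ν, RelP [] M A K → Step δ Ω K ν K' → Step δ Ω (C K) ν (C K'))
    (h : Answers δ Ω M A μ N M') : Answers δ Ω P B μ Q (C M') := by
  induction h with
  | step h hs h' => exact .step (hP _ h) (hC _ _ _ h hs) (hQ _ h')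
  | silent h hs _ ih => exact .silent (hP _ h) (hC _ _ _ h hs) ih

/-! ### Steps of related terms and their side conditions -/

theorem Step.op_update {o : S.Op} {Ms : Fin (S.arity o) → Tm S} {i : Fin (S.arity o)}
    {K K' : Tm S} {μ : Option (Label S)} (hv : ∀ j, j < i → Value (Ms j)) (h : Step δ Ω K μ K') :
    Step δ Ω (.op o (Function.update Ms i K)) μ (.op o (Function.update Ms i K')) := by
  have := Step.opCtx (Ms := Function.update Ms i K) i
    (fun j hj => by simpa [hj.ne] using hv j hj) (by simpa using h)
  simpa using this

theorem Step.record_update {n : ℕ} {ls : Fin n → ℕ} {Ms : Fin n → Tm S} {i : Fin n}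
    {K K' : Tm S} {μ : Option (Label S)} (hv : ∀ j, j < i → Value (Ms j)) (h : Step δ Ω K μ K') :
    Step δ Ω (.record n ls (Function.update Ms i K)) μ
      (.record n ls (Function.update Ms i K')) := by
  have := Step.recordCtx (ls := ls) (Ms := Function.update Ms i K) i
    (fun j hj => by simpa [hj.ne] using hv j hj) (by simpa using h)
  simpa using this

theorem RelP.forall_update {n : ℕ} {Ms Ms' : Fin n → Tm S} {As : Fin n → Ty S.Base}
    (h : ∀ i, RelP [] (Ms i) (As i) (Ms' i)) {i : Fin n} {N N' : Tm S} (hN : RelP [] N (As i) N') :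
    ∀ j, RelP [] (Function.update Ms i N j) (As j) (Function.update Ms' i N' j) :=
  EffLang.forall_update (P := fun i M M' => RelP [] M (As i) M') h hN

theorem RelP.ne_single {M M' : Tm S} {A : Ty S.Base} (h : RelP [] M A M')
    (hM : ∀ V, Value V → M ≠ .single V) : ∀ V, Value V → M' ≠ .single V := by
  rintro V hV rfl
  cases h with
  | single h => exact hM _ (hV.of_relP' h) rfl

theorem RelP.ne_single' {M M' : Tm S} {A : Ty S.Base} (h : RelP [] M A M')
    (hM : ∀ V, Value V → M' ≠ .single V) : ∀ V, Value V → M ≠ .single V := by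
  rintro V hV rfl
  cases h with
  | single h => exact hM _ (hV.of_relP h) rfl

/-- Normalisation yields a query of type `[R]` at `db`, so `Ω` answers it with a value of the flat
type `[R]`. -/
theorem RelP.response (hΩ : RespectsTypes Ω) {M M' q V : Tm S} {R : Row S.Base}
    (h : RelQ [] M (.bag R.toTy) M') (hq : Normalises M q) (hV : (q, V) ∈ Ω) :
    RelP [] V (.bag R.toTy) V := by
  obtain ⟨hv, ht⟩ := hΩ q V hV
  exact hv.relP_self (ht R (h.typed_of_normalises R.arrowFree hq)).some R.arrowFree

theorem RelP.delta (hδ : δ.RespectsTypes) {o : S.Op} {cs : Fin (S.arity o) → S.Const} {O : S.Base}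
    (h : ∀ i, S.constTy (cs i) = S.opDom o i) (hO : S.opCod o = O) :
    RelP [] (.const (δ o cs)) (.base O) (.const (δ o cs)) :=
  .const ((hδ o cs h).trans hO)

theorem RelP.const_inv {Γ : List (Ty S.Base)} {c : S.Const} {O : S.Base} {M' : Tm S}
    (h : RelP Γ (.const c) (.base O) M') : M' = .const c ∧ S.constTy c = O := by
  cases h with | const h => exact ⟨rfl, h⟩

theorem RelP.const_inv' {Γ : List (Ty S.Base)} {c : S.Const} {O : S.Base} {M : Tm S}
    (h : RelP Γ M (.base O) (.const c)) : M = .const c ∧ S.constTy c = O := by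
  cases h with | const h => exact ⟨rfl, h⟩

/-- The translation needs a step of its own only where an `any`-function value stands in head
position: it must project before the argument can be evaluated or β can fire. -/
theorem RelP.answers (hδ : δ.RespectsTypes) (hΩ : RespectsTypes Ω) {M M' N : Tm S} {A : Ty S.Base}
    {μ : Option (Label S)} (h : RelP [] M A M') (hs : Step δ Ω M μ N) :
    Answers δ Ω M A μ N M' := by
  induction hs generalizing A M' with
  | @delta o cs =>
    have h' := h
    cases h with
    | @op _ _ _ Ms' _ h ho =>
      obtain rfl : Ms' = fun i => .const (cs i) := funext fun i => (h i).const_inv.1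
      exact .step h' .delta (.delta hδ (fun i => (h i).const_inv.2) ho)
  | beta hv =>
    have h' := h
    cases h with
    | appPl h₁ h₂ =>
      cases h₁ with
      | lamPl h₁ => exact .step h' (.beta (hv.of_relP h₂)) (h₁.inst h₂ (h₂.relQ hv))
    | appAny h₁ h₂ =>
      cases h₁ with
      | lamAny h₁ h₃ h₀ hP =>
        refine .silent h' (.appL (.proj 0 rfl fun j => ?_)) ?_
        · match j with
          | 0 => exact h₀ ▸ .lam _ _ _
          | 1 => exact hP ▸ .lam _ _ _
        · rw [h₀]
          exact .step (.appLam h₁ h₂) (.beta (hv.of_relP h₂)) (h₁.inst h₂ (h₂.relQ hv))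
    | appLam h₁ h₂ => exact .step h' (.beta (hv.of_relP h₂)) (h₁.inst h₂ (h₂.relQ hv))
  | betaRec hv =>
    have h' := h
    cases h with
    | appPl h₁ h₂ =>
      have hr := h₁
      cases h₁ with
      | recFn h₁ =>
        exact .step h' (.betaRec (hv.of_relP h₂))
          (h₁.inst₂ h₂ (h₂.relQ hv) hr (hr.relQ (.recFn _ _ _)))
    | appAny h₁ h₂ => cases h₁
  | proj i hi hv =>
    have h' := h
    cases h with
    | proj j h hl hA =>
      cases h with
      | record hinj h =>
        obtain rfl := hinj (hi.trans hl.symm)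
        subst hA
        exact .step h' (.proj i hi fun j => (hv j).of_relP (h j)) (h i)
  | iteTrue =>
    have h' := h
    cases h with
    | ite h₁ h₂ => cases h₁; exact .step h' .iteTrue h₂
  | iteFalse =>
    have h' := h
    cases h with
    | ite h₁ h₂ => cases h₁; exact .step h' .iteFalse .empty
  | singleton hv =>
    have h' := h
    cases h with
    | single h => exact .step h' (.singleton (hv.of_relP h)) (.union (.single h) .empty)
  | unionEmpty hv =>
    have h' := h
    cases h with
    | union h₁ h₂ => cases h₁; exact .step h' (.unionEmpty (hv.of_relP h₂)) h₂
  | unionAssoc hv hw hw' =>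
    have h' := h
    cases h with
    | union h₁ h₂ =>
      cases h₁ with
      | union h₁ h₃ =>
        cases h₁ with
        | single h₁ =>
          exact .step h' (.unionAssoc (hv.of_relP h₁) (hw.of_relP h₃) (hw'.of_relP h₂))
            (.union (.single h₁) (.union h₃ h₂))
  | forEmpty =>
    have h' := h
    cases h with
    | forIn h₁ h₂ => cases h₁; exact .step h' .forEmpty .empty
  | forUnion hv hw =>
    have h' := h
    cases h with
    | forIn h₁ h₂ =>
      cases h₁ with
      | union h₁ h₃ =>
        cases h₁ with
        | single h₁ =>
          exact .step h' (.forUnion (hv.of_relP h₁) (hw.of_relP h₃))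
            (.union (h₂.inst h₁ (h₁.relQ hv)) (.forIn h₃ h₂))
  | foldEmpty =>
    have h' := h
    cases h with
    | fold h₁ h₂ h₃ => cases h₁; exact .step h' .foldEmpty h₂
  | foldUnion hv hw =>
    have h' := h
    cases h with
    | fold h₁ h₂ h₃ =>
      cases h₁ with
      | union h₁ h₄ =>
        cases h₁ with
        | single h₁ =>
          exact .step h' (.foldUnion (hv.of_relP h₁) (hw.of_relP h₄))
            (.appPl (.appPl h₃ h₁) (.fold h₄ h₂ h₃))
  | query hq hV =>
    have h' := h
    cases h with
    | query h =>
      exact .step h' (.query ((h.normalises_iff (Row.arrowFree _)).1 hq) hV)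
        (.response hΩ h hq hV)
  | @opCtx o Ms μ N i hv hs ih =>
    cases h with
    | @op _ _ _ Ms' _ h ho =>
      have := (ih (h i)).lift (fun K => .op o (Function.update Ms' i K)) (P := .op o Ms)
        (fun K hK => .op (by simpa using RelP.forall_update h hK) ho)
        (fun K hK => .op (RelP.forall_update h hK) ho)
        (fun K K' ν _ hK => .op_update (fun j hj => (hv j hj).of_relP (h j)) hK)
      simpa using this
  | @recordCtx n ls Ms μ N i hv hs ih =>
    cases h with
    | @record _ _ _ _ Ms' As hl h =>
      have := (ih (h i)).lift (fun K => .record n ls (Function.update Ms' i K))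
        (P := .record n ls Ms)
        (fun K hK => .record hl (by simpa using RelP.forall_update h hK))
        (fun K hK => .record hl (RelP.forall_update h hK))
        (fun K K' ν _ hK => .record_update (fun j hj => (hv j hj).of_relP (h j)) hK)
      simpa using this
  | appL hs ih =>
    cases h with
    | appPl h₁ h₂ =>
      exact (ih h₁).lift (fun K => .app K _) (fun _ h => .appPl h h₂) (fun _ h => .appPl h h₂)
        fun _ _ _ _ => .appL
    | appAny h₁ h₂ =>
      exact (ih h₁).lift (fun K => .app (.proj K 1) _) (fun _ h => .appAny h h₂)
        (fun _ h => .appAny h h₂) fun _ _ _ _ h => .appL (.projCtx h)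
    | appLam h₁ h₂ => cases hs
  | appR hv hs ih =>
    have h' := h
    cases h with
    | appPl h₁ h₂ =>
      exact (ih h₂).lift (fun K => .app _ K) (fun _ h => .appPl h₁ h) (fun _ h => .appPl h₁ h)
        fun _ _ _ _ => .appR (hv.of_relP h₁)
    | appAny h₁ h₂ =>
      -- The source head is a value and lets the argument step, while the translated head is still a
      -- projection. It is reduced first, and the argument then runs in the `appLam` state.
      obtain ⟨M, M₁, M₂, A₁, A₂, Ps, rfl, rfl, h₁, h₃, h₀, hP⟩ := h₁.any_value hv
      refine .silent h' (.appL (.proj 0 rfl fun j => ?_)) ?_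
      · match j with
        | 0 => exact h₀ ▸ .lam _ _ _
        | 1 => exact hP ▸ .lam _ _ _
      · rw [h₀]
        exact (ih h₂).lift (fun K => .app _ K) (fun _ h => .appLam h₁ h)
          (fun _ h => .appLam h₁ h) fun _ _ _ _ => .appR (.lam _ _ _)
    | appLam h₁ h₂ =>
      exact (ih h₂).lift (fun K => .app _ K) (fun _ h => .appLam h₁ h) (fun _ h => .appLam h₁ h)
        fun _ _ _ _ => .appR (.lam _ _ _)
  | projCtx hs ih =>
    cases h with
    | proj i h hl hA =>
      exact (ih h).lift (fun K => .proj K _) (fun _ h => .proj i h hl hA)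
        (fun _ h => .proj i h hl hA) fun _ _ _ _ => .projCtx
  | singleCtx hs ih =>
    cases h with
    | single h =>
      exact (ih h).lift .single (fun _ => .single) (fun _ => .single) fun _ _ _ _ => .singleCtx
  | unionL hM hs ih =>
    cases h with
    | union h₁ h₂ =>
      exact (ih h₁).lift (fun K => .union K _) (fun _ h => .union h h₂) (fun _ h => .union h h₂)
        fun _ _ _ h => .unionL (h.ne_single hM)
  | unionRSingle hv hs ih =>
    cases h with
    | union h₁ h₂ =>
      cases h₁ with
      | single h₁ =>
        exact (ih h₂).lift (fun K => .union _ K) (fun _ h => .union (.single h₁) h)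
          (fun _ h => .union (.single h₁) h) fun _ _ _ _ => .unionRSingle (hv.of_relP h₁)
  | unionRValue hv hs ih =>
    cases h with
    | union h₁ h₂ =>
      exact (ih h₂).lift (fun K => .union _ K) (fun _ h => .union h₁ h)
        (fun _ h => .union h₁ h) fun _ _ _ _ => .unionRValue (hv.of_relP h₁)
  | forCtx hs ih =>
    cases h with
    | @forIn _ _ _ _ _ _ A' _ h₁ h₂ =>
      exact (ih h₁).lift (fun K => .for A' K _) (fun _ h => .forIn h h₂) (fun _ h => .forIn h h₂)
        fun _ _ _ _ => .forCtx
  | iteCtx hs ih =>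
    cases h with
    | ite h₁ h₂ =>
      exact (ih h₁).lift (fun K => .ite K _) (fun _ h => .ite h h₂) (fun _ h => .ite h h₂)
        fun _ _ _ _ => .iteCtx
  | foldCtx hs ih =>
    cases h with
    | fold h₁ h₂ h₃ =>
      exact (ih h₁).lift (fun K => .fold K _ _) (fun _ h => .fold h h₂ h₃)
        (fun _ h => .fold h h₂ h₃) fun _ _ _ _ => .foldCtx

/-- The first alternative arises from projecting a copy out of the pair of an applied
`any`-function, possibly inside an evaluation context; any other step is matched by exactly one
source step. -/
theorem RelP.answered (hδ : δ.RespectsTypes) (hΩ : RespectsTypes Ω) {M M' N' : Tm S}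
    {A : Ty S.Base} {μ : Option (Label S)} (h : RelP [] M A M') (hs : Step δ Ω M' μ N') :
    (μ = none ∧ RelP [] M A N') ∨ ∃ N, Step δ Ω M μ N ∧ RelP [] N A N' := by
  generalize hΓ : [] = Γ at h
  induction h generalizing N' with
  | var => cases hs
  | const => cases hs
  | @op _ o Ms _ _ h ho ih =>
    subst hΓ
    cases hs with
    | @delta _ cs =>
      obtain rfl : Ms = fun i => .const (cs i) := funext fun i => (h i).const_inv'.1
      exact .inr ⟨_, .delta, .delta hδ (fun i => (h i).const_inv'.2) ho⟩
    | opCtx i hv hs =>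
      have hv := fun j hj => (hv j hj).of_relP' (h j)
      rcases ih i hs rfl with ⟨hμ, hN⟩ | ⟨N, hs, hN⟩
      · exact .inl ⟨hμ, .op (by simpa using RelP.forall_update h hN) ho⟩
      · exact .inr ⟨_, .opCtx i hv hs, .op (RelP.forall_update h hN) ho⟩
  | lamPl => cases hs
  | lamDb => cases hs
  | lamAny _ _ h₀ h₁ =>
    cases hs with
    | recordCtx i _ hs =>
      match i with
      | 0 => rw [h₀] at hs; cases hs
      | 1 => rw [h₁] at hs; cases hs
  | appPl h₁ h₂ ih₁ ih₂ =>
    subst hΓ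
    cases hs with
    | beta hv =>
      have hv := hv.of_relP' h₂
      cases h₁ with
      | lamPl h₁ => exact .inr ⟨_, .beta hv, h₁.inst h₂ (h₂.relQ hv)⟩
    | betaRec hv =>
      have hv := hv.of_relP' h₂
      have hr := h₁
      cases h₁ with
      | recFn h₁ =>
        exact .inr ⟨_, .betaRec hv,
          h₁.inst₂ h₂ (h₂.relQ hv) hr (hr.relQ (.recFn _ _ _))⟩
    | appL hs =>
      rcases ih₁ hs rfl with ⟨hμ, hN⟩ | ⟨N, hs, hN⟩
      · exact .inl ⟨hμ, .appPl hN h₂⟩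
      · exact .inr ⟨_, .appL hs, .appPl hN h₂⟩
    | appR hv hs =>
      rcases ih₂ hs rfl with ⟨hμ, hN⟩ | ⟨N, hs, hN⟩
      · exact .inl ⟨hμ, .appPl h₁ hN⟩
      · exact .inr ⟨_, .appR (hv.of_relP' h₁) hs, .appPl h₁ hN⟩
  | appAny h₁ h₂ ih₁ ih₂ =>
    subst hΓ
    cases hs with
    | appL hs =>
      cases hs with
      | proj i hi =>
        cases h₁ with
        | lamAny h₁ _ h₀ =>
          match i with
          | 0 =>
            rw [h₀]
            exact .inl ⟨rfl, .appLam h₁ h₂⟩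
          | 1 => exact absurd hi (by simp)
      | projCtx hs =>
        rcases ih₁ hs rfl with ⟨hμ, hN⟩ | ⟨N, hs, hN⟩
        · exact .inl ⟨hμ, .appAny hN h₂⟩
        · exact .inr ⟨_, .appL hs, .appAny hN h₂⟩
    | appR hv hs =>
      -- The head is a projection, which is not a value, so the argument cannot move yet.
      exfalso
      cases hv with
      | @coll _ Vs hM => cases Vs <;> cases hM
  | appLam h₁ h₂ ih₁ ih₂ =>
    subst hΓ
    cases hs with
    | beta hv =>
      have hv := hv.of_relP' h₂
      exact .inr ⟨_, .beta hv, h₁.inst h₂ (h₂.relQ hv)⟩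
    | appL hs => cases hs
    | appR hv hs =>
      rcases ih₂ hs rfl with ⟨hμ, hN⟩ | ⟨N, hs, hN⟩
      · exact .inl ⟨hμ, .appLam h₁ hN⟩
      · refine .inr ⟨_, .appR (.lam _ _ _) hs, .appLam h₁ hN⟩
  | ite h₁ h₂ ih₁ ih₂ =>
    subst hΓ
    cases hs with
    | iteTrue => cases h₁; exact .inr ⟨_, .iteTrue, h₂⟩
    | iteFalse => cases h₁; exact .inr ⟨_, .iteFalse, .empty⟩
    | iteCtx hs =>
      rcases ih₁ hs rfl with ⟨hμ, hN⟩ | ⟨N, hs, hN⟩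
      · exact .inl ⟨hμ, .ite hN h₂⟩
      · exact .inr ⟨_, .iteCtx hs, .ite hN h₂⟩
  | record hl h ih =>
    subst hΓ
    cases hs with
    | recordCtx i hv hs =>
      have hv := fun j hj => (hv j hj).of_relP' (h j)
      rcases ih i hs rfl with ⟨hμ, hN⟩ | ⟨N, hs, hN⟩
      · exact .inl ⟨hμ, .record hl (by simpa using RelP.forall_update h hN)⟩
      · exact .inr ⟨_, .recordCtx i hv hs, .record hl (RelP.forall_update h hN)⟩
  | proj i h hl hA ih =>
    subst hΓ
    cases hs with
    | proj j hj hv =>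
      cases h with
      | record hinj h =>
        obtain rfl := hinj (hj.trans hl.symm)
        subst hA
        exact .inr ⟨_, .proj j hl fun i => (hv i).of_relP' (h i), h j⟩
    | projCtx hs =>
      rcases ih hs rfl with ⟨hμ, hN⟩ | ⟨N, hs, hN⟩
      · exact .inl ⟨hμ, .proj i hN hl hA⟩
      · exact .inr ⟨_, .projCtx hs, .proj i hN hl hA⟩
  | empty => cases hs
  | single h ih =>
    subst hΓ
    cases hs with
    | singleton hv => exact .inr ⟨_, .singleton (hv.of_relP' h), .union (.single h) .empty⟩
    | singleCtx hs =>
      rcases ih hs rfl with ⟨hμ, hN⟩ | ⟨N, hs, hN⟩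
      · exact .inl ⟨hμ, .single hN⟩
      · exact .inr ⟨_, .singleCtx hs, .single hN⟩
  | union h₁ h₂ ih₁ ih₂ =>
    subst hΓ
    cases hs with
    | unionEmpty hv => cases h₁; exact .inr ⟨_, .unionEmpty (hv.of_relP' h₂), h₂⟩
    | unionAssoc hv hw hw' =>
      cases h₁ with
      | union h₁ h₃ =>
        cases h₁ with
        | single h₁ =>
          exact .inr ⟨_, .unionAssoc (hv.of_relP' h₁) (hw.of_relP' h₃) (hw'.of_relP' h₂),
            .union (.single h₁) (.union h₃ h₂)⟩
    | unionL hM hs =>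
      rcases ih₁ hs rfl with ⟨hμ, hN⟩ | ⟨N, hs, hN⟩
      · exact .inl ⟨hμ, .union hN h₂⟩
      · exact .inr ⟨_, .unionL (h₁.ne_single' hM) hs, .union hN h₂⟩
    | unionRSingle hv hs =>
      rcases ih₂ hs rfl with ⟨hμ, hN⟩ | ⟨N, hs, hN⟩
      · exact .inl ⟨hμ, .union h₁ hN⟩
      · cases h₁ with
        | single h₁ => exact .inr ⟨_, .unionRSingle (hv.of_relP' h₁) hs, .union (.single h₁) hN⟩
    | unionRValue hv hs =>
      rcases ih₂ hs rfl with ⟨hμ, hN⟩ | ⟨N, hs, hN⟩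
      · exact .inl ⟨hμ, .union h₁ hN⟩
      · exact .inr ⟨_, .unionRValue (hv.of_relP' h₁) hs, .union h₁ hN⟩
  | forIn h₁ h₂ ih₁ ih₂ =>
    subst hΓ
    cases hs with
    | forEmpty => cases h₁; exact .inr ⟨_, .forEmpty, .empty⟩
    | forUnion hv hw =>
      cases h₁ with
      | union h₁ h₃ =>
        cases h₁ with
        | single h₁ =>
          have hv := hv.of_relP' h₁
          exact .inr ⟨_, .forUnion hv (hw.of_relP' h₃),
            .union (h₂.inst h₁ (h₁.relQ hv)) (.forIn h₃ h₂)⟩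
    | forCtx hs =>
      rcases ih₁ hs rfl with ⟨hμ, hN⟩ | ⟨N, hs, hN⟩
      · exact .inl ⟨hμ, .forIn hN h₂⟩
      · exact .inr ⟨_, .forCtx hs, .forIn hN h₂⟩
  | query h =>
    subst hΓ
    cases hs with
    | query hq hV =>
      have hq := (h.normalises_iff (Row.arrowFree _)).2 hq
      exact .inr ⟨_, .query hq hV, .response hΩ h hq hV⟩
  | recFn => cases hs
  | fold h₁ h₂ h₃ ih₁ =>
    subst hΓ
    cases hs with
    | foldEmpty => cases h₁; exact .inr ⟨_, .foldEmpty, h₂⟩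
    | foldUnion hv hw =>
      cases h₁ with
      | union h₁ h₄ =>
        cases h₁ with
        | single h₁ =>
          exact .inr ⟨_, .foldUnion (hv.of_relP' h₁) (hw.of_relP' h₄),
            .appPl (.appPl h₃ h₁) (.fold h₄ h₂ h₃)⟩
    | foldCtx hs =>
      rcases ih₁ hs rfl with ⟨hμ, hN⟩ | ⟨N, hs, hN⟩
      · exact .inl ⟨hμ, .fold hN h₂ h₃⟩
      · exact .inr ⟨_, .foldCtx hs, .fold hN h₂ h₃⟩

/-! ### The two weak simulations -/

theorem RelP.isSimulation (hδ : δ.RespectsTypes) (hΩ : RespectsTypes Ω) (A : Ty S.Base) :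
    IsSimulation (Step δ Ω) (Step δ Ω) fun M M' => RelP [] M A M' :=
  fun _ _ _ _ h hs => (h.answers hδ hΩ hs).hatWeak

theorem RelP.isSimulation_flip (hδ : δ.RespectsTypes) (hΩ : RespectsTypes Ω) (A : Ty S.Base) :
    IsSimulation (Step δ Ω) (Step δ Ω) fun M' M => RelP [] M A M' := by
  intro M' M μ N' h hs
  rcases h.answered hδ hΩ hs with ⟨rfl, hN⟩ | ⟨N, hs, hN⟩
  · exact ⟨M, .refl, hN⟩
  · refine ⟨N, ?_, hN⟩
    cases μ with
    | none => exact .single hs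
    | some l => exact ⟨_, _, .refl, hs, .refl⟩

end Steps

end EffLang

theorem mainTheorem1 (S : EffLang.Signature) (δ : EffLang.OpInterp S)
    (Ω : Set (EffLang.Label S)) (hδ : δ.RespectsTypes) (hΩ : EffLang.RespectsTypes Ω)
    (M : EffLang.Tm S) (A : EffLang.Ty S.Base) (d : EffLang.Typed [] M A EffLang.Eff.pl) :
    EffLang.TraceEquiv (EffLang.Step δ Ω) (EffLang.Step δ Ω) M (d.dup EffLang.Ground.pl) := by
  have h := d.related_dup.1 (.refl _)
  exact Set.Subset.antisymm ((EffLang.RelP.isSimulation hδ hΩ A).Tr_subset h)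
    ((EffLang.RelP.isSimulation_flip hδ hΩ A).Tr_subset h)
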